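/- Let $\mathbf{k}$ be a field of characteristic $0$. **Symmetric functions in superspace.** For $N\ge 0$ let $\mathbf{k}[x,\theta]_N$ be the polynomial superalgebra in even variables $x_1,\dots,x_N$ and odd variables $\theta_1,\dots,\theta_N$, with the diagonal action of the symmetric group $\mathfrak S_N$. Let $\mathbf{\Lambda}_{n,m}$ be the inverse limit over $N$ of the spaces of $\mathfrak S_N$-invariants of degree $n$ in $x$ and $m$ in $\theta$ (transition maps: setting the extra variables to $0$), and $\mathbf{\Lambda}=\bigoplus_{n,m}\mathbf{\Lambda}_{n,m}$. It is graded by $n+m$, has parity $m \bmod 2$, and is a Hopf superalgebra with comultiplication $\Delta f=f(x,y;\theta,\varphi)$, where $g\otimes h$ stands for $g(x;\theta)\,h(y;\varphi)$, and with the constant term as counit. Let $\mathbf{k}[\varepsilon]$ be generated by an odd $\varepsilon$ with $\varepsilon^2=0$, and let $\zeta_S\colon\mathbf{\Lambda}\to\mathbf{k}[\varepsilon]$ be the specialization $x_1=1$, $\theta_1=\varepsilon$, $x_i=\theta_i=0$ for $i\ge2$. For a superpartition $\Lambda=(\Lambda_1,\dots,\Lambda_m;\Lambda_{m+1},\dots)$,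 padded by zeros to length $N$, the monomial symmetric function is $$m_\Lambda=(\#\mathrm{Aut}(\Lambda^s))^{-1}\sum_{\sigma\in\mathfrak S_N}\sigma(x^\Lambda\theta_1\cdots\theta_m)$$ in $N$ variables, $\mathrm{Aut}(\Lambda^s)$ being the group of permutations of equal entries of $\Lambda^s=(\Lambda_{m+1},\dots,\Lambda_N)$ (and $m_\Lambda=0$ if $N$ is less than the length of $\Lambda$). Put $\widetilde e_n=m_{(0;1^n)}$, so that $\widetilde e_n=\sum_i\theta_i\sum_{j_1<\dots<j_n,\ j_a\ne i}x_{j_1}\cdots x_{j_n}$. **The chromatic Hopf superalgebra.** Consider finite simple graphs $(V,E)$ with a set $W\subset V$ of white vertices (the others being black). Let $\mathcal G$ be the $\mathbf{k}$-algebra generated by the isomorphism classes $[G]$ of connected triples $G=(V,W,E)$ with $\#W\le1$, subject to $[G_1][G_2]=(-1)^{\#W_1\#W_2}[G_2][G_1]$; a product $[G_1]\cdots[G_l]$ is the class of the disjoint union $G_1|\cdots|G_l$. Let $\mathcal G_{n,m}$ be spanned by the classes with $n$ black and $m$ white vertices; $\mathcal G$ is graded by $n+m$ (the number of vertices) and has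 parity $m\bmod 2$. The comultiplication is the superalgebra morphism $\Delta\colon\mathcal G\to\mathcal G\otimes\mathcal G$ given on connected $G$ by $$\Delta([G])=\tfrac12\sum_{V=V_1\sqcup V_2}\bigl([G|_{V_1}]\otimes[G|_{V_2}]+(-1)^{\#W_1\#W_2}[G|_{V_2}]\otimes[G|_{V_1}]\bigr),\qquad W_i=W\cap V_i,$$ the counit sends every nonempty graph to $0$, and the supercharacter $\zeta_{\mathrm{ch}}\colon\mathcal G\to\mathbf{k}[\varepsilon]$ is the algebra morphism that on a connected $G$ is $1$ if $E=\emptyset,\ \#W=0$, is $\varepsilon$ if $E=\emptyset,\ \#W=1$, and is $0$ otherwise. **Proposition.** There is exactly one even morphism $\Psi_{\mathrm{ch}}\colon\mathcal G\to\mathbf{\Lambda}$ of graded Hopf superalgebras with $\zeta_S\circ\Psi_{\mathrm{ch}}=\zeta_{\mathrm{ch}}$. For every $n\ge0$, if $K_{n+1,1}=(V,W,E)$ is a triple such that $(V,E)$ is the complete graph on $n+1$ vertices and $\#W=1$, then its chromatic symmetric function in superspace is $$\Psi_{\mathrm{ch}}([K_{n+1,1}])=n!\,\widetilde e_n.$$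 -/

import Mathlib

noncomputable section

namespace SuperChromatic

open scoped TensorProduct DirectSum

universe u

section SymmetricFunctions

variable (k : Type u) [Field k]

/-- The polynomial superalgebra `k[x, θ]_N` in even variables `x_i` and odd variables `θ_i`. -/
abbrev SuperPoly (N : ℕ) : Type u :=
  MvPolynomial (Fin N) k ⊗[k] ExteriorAlgebra k (Fin N → k)

/-- The substitution `x_i ↦ x_{φ i}`, `θ_i ↦ θ_{φ i}`, both variables being sent to `0`
when `φ i = none`. -/
def subst {N M : ℕ} (φ : Fin N → Option (Fin M)) : SuperPoly k N →ₐ[k] SuperPoly k M :=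
  Algebra.TensorProduct.map
    (MvPolynomial.aeval fun i => (φ i).elim 0 MvPolynomial.X)
    (ExteriorAlgebra.map
      (Fintype.linearCombination k fun i => (φ i).elim 0 fun j => Pi.single j (1 : k)))

/-- The diagonal action of a permutation `σ` on `k[x, θ]_N`. -/
def permAct {N : ℕ} (σ : Equiv.Perm (Fin N)) : SuperPoly k N →ₐ[k] SuperPoly k N :=
  subst k fun i => some (σ i)

/-- The map `k[x, θ]_M → k[x, θ]_N` that sets the variables with index `≥ N` to zero. -/
def trunc (M N : ℕ) : SuperPoly k M →ₐ[k] SuperPoly k N :=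
  subst k fun i => if h : (i : ℕ) < N then some ⟨i, h⟩ else none

/-- Elements of `k[x, θ]_N` homogeneous of degree `n` in `x` and of degree `m` in `θ`. -/
def bihomogeneous (N n m : ℕ) : Submodule k (SuperPoly k N) :=
  Submodule.map₂ (TensorProduct.mk k (MvPolynomial (Fin N) k) (ExteriorAlgebra k (Fin N → k)))
    (MvPolynomial.homogeneousSubmodule (Fin N) k n) (⋀[k]^m (Fin N → k))

/-- `𝚲_{n,m}`: compatible families of symmetric polynomials in `N` supervariables (`N ≥ 0`) of
bidegree `(n, m)`, that is, the inverse limit over `N`. -/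
def SymBi (n m : ℕ) : Submodule k (∀ N, SuperPoly k N) where
  carrier := {f | (∀ N, f N ∈ bihomogeneous k N n m) ∧
    (∀ N (σ : Equiv.Perm (Fin N)), permAct k σ (f N) = f N) ∧
    ∀ N M, N ≤ M → trunc k M N (f M) = f N}
  add_mem' {f g} hf hg := ⟨fun N => add_mem (hf.1 N) (hg.1 N),
    fun N σ => by simp [hf.2.1 N σ, hg.2.1 N σ],
    fun N M h => by simp [hf.2.2 N M h, hg.2.2 N M h]⟩
  zero_mem' := ⟨fun N => zero_mem _, fun N σ => by simp, fun N M h => by simp⟩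
  smul_mem' c f hf := ⟨fun N => Submodule.smul_mem _ c (hf.1 N),
    fun N σ => by simp [hf.2.1 N σ], fun N M h => by simp [hf.2.2 N M h]⟩

theorem one_mem_symBi : (1 : ∀ N, SuperPoly k N) ∈ SymBi k 0 0 := by
  refine ⟨fun N => ?_, fun N σ => by simp, fun N M h => by simp⟩
  refine Submodule.apply_mem_map₂ (TensorProduct.mk k _ _) (m := 1) (n := 1) ?_ ?_
  · exact MvPolynomial.isHomogeneous_one _ _
  · simp

theorem mul_mem_bihomogeneous {N n m n' m' : ℕ} {f g : SuperPoly k N}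
    (hf : f ∈ bihomogeneous k N n m) (hg : g ∈ bihomogeneous k N n' m') :
    f * g ∈ bihomogeneous k N (n + n') (m + m') := by
  have key : bihomogeneous k N n m * bihomogeneous k N n' m' ≤
      bihomogeneous k N (n + n') (m + m') := by
    rw [bihomogeneous, bihomogeneous, Submodule.map₂_eq_span_image2,
      Submodule.map₂_eq_span_image2, Submodule.span_mul_span, Submodule.span_le]
    rintro _ ⟨_, ⟨p, hp, a, ha, rfl⟩, _, ⟨q, hq, b, hb, rfl⟩, rfl⟩
    simp only [TensorProduct.mk_apply, Algebra.TensorProduct.tmul_mul_tmul]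
    refine Submodule.apply_mem_map₂ (TensorProduct.mk k _ _) (m := p * q) (n := a * b) ?_ ?_
    · exact MvPolynomial.IsHomogeneous.mul hp hq
    · rw [ExteriorAlgebra.exteriorPower, pow_add]
      exact Submodule.mul_mem_mul ha hb
  exact key (Submodule.mul_mem_mul hf hg)

theorem mul_mem_symBi {n m n' m' : ℕ} {f g : ∀ N, SuperPoly k N}
    (hf : f ∈ SymBi k n m) (hg : g ∈ SymBi k n' m') : f * g ∈ SymBi k (n + n') (m + m') :=
  ⟨fun N => mul_mem_bihomogeneous k (hf.1 N) (hg.1 N),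
    fun N σ => by simp [hf.2.1 N σ, hg.2.1 N σ],
    fun N M h => by simp [hf.2.2 N M h, hg.2.2 N M h]⟩

/-- The algebra `𝚲 = ⨁_{n,m} 𝚲_{n,m}` of symmetric functions in superspace. -/
def SymFun : Subalgebra k (∀ N, SuperPoly k N) :=
  (⨆ p : ℕ × ℕ, SymBi k p.1 p.2).toSubalgebra
    (Submodule.mem_iSup_of_mem (0, 0) (one_mem_symBi k))
    (by
      intro f g hf hg
      have key : (⨆ p : ℕ × ℕ, SymBi k p.1 p.2) * (⨆ p : ℕ × ℕ, SymBi k p.1 p.2) ≤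
          ⨆ p : ℕ × ℕ, SymBi k p.1 p.2 := by
        rw [Submodule.iSup_mul]
        refine iSup_le fun p => ?_
        rw [Submodule.mul_iSup]
        refine iSup_le fun q => Submodule.mul_le.2 fun a ha b hb => ?_
        exact Submodule.mem_iSup_of_mem (p.1 + q.1, p.2 + q.2) (mul_mem_symBi k ha hb)
      exact key (Submodule.mul_mem_mul hf hg))

/-- `𝚲^d = ⨁_{n+m=d} 𝚲_{n,m}`. -/
def SymFun.degreePart (d : ℕ) : Submodule k (SymFun k) :=
  (⨆ p : {p : ℕ × ℕ // p.1 + p.2 = d}, SymBi k p.1.1 p.1.2).comap (SymFun k).val.toLinearMap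

/-- The even (`p = 0`) and odd (`p = 1`) part of `𝚲`: the sum of the `𝚲_{n,m}` with `m ≡ p`
modulo `2`. -/
def SymFun.parityPart (p : ZMod 2) : Submodule k (SymFun k) :=
  (⨆ q : {q : ℕ × ℕ // (q.2 : ZMod 2) = p}, SymBi k q.1.1 q.1.2).comap (SymFun k).val.toLinearMap

/-- The supercharacter `ζ_S : 𝚲 → k[ε]`, the specialization `x_1 = 1`, `θ_1 = ε`,
`x_i = θ_i = 0` for `i ≥ 2`. -/
def zetaS : SymFun k →ₐ[k] DualNumber k :=
  (Algebra.TensorProduct.productMap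
    (MvPolynomial.aeval fun _ : Fin 1 => (1 : DualNumber k))
    (ExteriorAlgebra.lift k
      ⟨(LinearMap.toSpanSingleton k (DualNumber k) DualNumber.eps) ∘ₗ LinearMap.proj (0 : Fin 1),
        fun v => by simp⟩)).comp
    ((Pi.evalAlgHom k (fun N => SuperPoly k N) 1).comp (SymFun k).val)

/-- The bilinear extension of `f ⊗ g ↦ f(x_1, …, x_N; θ_1, …, θ_N) · g(y_1, …, y_M; φ_1, …, φ_M)`,
where `y_j = x_{N+j}` and `φ_j = θ_{N+j}`. -/
def evalTensor (N M : ℕ) : SymFun k ⊗[k] SymFun k →ₗ[k] SuperPoly k (N + M) :=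
  TensorProduct.lift ((LinearMap.mul k (SuperPoly k (N + M))).compl₁₂
    ((subst k fun i => some (Fin.castAdd M i)).toLinearMap ∘ₗ LinearMap.proj N ∘ₗ
      (SymFun k).val.toLinearMap)
    ((subst k fun j => some (Fin.natAdd N j)).toLinearMap ∘ₗ LinearMap.proj M ∘ₗ
      (SymFun k).val.toLinearMap))

/-- `t = Δ(f)` for the comultiplication `Δ f = f(x, y; θ, φ)` of `𝚲`: splitting the
supervariables into two sets turns `f` into `t`, where `g ⊗ h` stands for
`g(x; θ) h(y; φ)`. -/
def SymFun.IsComul (f : SymFun k) (t : SymFun k ⊗[k] SymFun k) : Prop :=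
  ∀ N M : ℕ, evalTensor k N M t = f.1 (N + M)

/-- Superpartitions `(Λ^a; Λ^s)`: `Λ^a` is strictly decreasing with entries `≥ 0`, and `Λ^s` is a
partition. -/
structure SuperPartition where
  antisym : List ℕ
  sym : List ℕ
  antisym_strict : antisym.Pairwise (· > ·)
  sym_antitone : sym.Pairwise (· ≥ ·)
  sym_pos : ∀ a ∈ sym, 0 < a

/-- The monomial symmetric function `m_Λ` in superspace, as the family of its polynomials in `N`
supervariables: with `m` the length of `Λ^a` and `Λ` padded by zeros to length `N`, it is
`(# Aut Λ^s)⁻¹ ∑_σ σ(x^Λ θ_1 ⋯ θ_m)`, where `Aut Λ^s` permutes equal entries of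
`Λ^s = (Λ_{m+1}, …, Λ_N)`; it is zero if `N` is smaller than the length of `Λ`. -/
def monomialSym (L : SuperPartition) (N : ℕ) : SuperPoly k N :=
  if L.antisym.length + L.sym.length ≤ N then
    let tail : List ℕ :=
      L.sym ++ List.replicate (N - (L.antisym.length + L.sym.length)) 0
    ((∏ v ∈ tail.toFinset, (tail.count v).factorial : ℕ) : k)⁻¹ •
      ∑ σ : Equiv.Perm (Fin N), permAct k σ
        ((∏ i : Fin N, (MvPolynomial.X i : MvPolynomial (Fin N) k) ^
            (L.antisym ++ tail).getD i 0) ⊗ₜ[k]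
          (((List.finRange N).take L.antisym.length).map
            fun i => ExteriorAlgebra.ι k (Pi.single i (1 : k) : Fin N → k)).prod)
  else 0

/-- The superpartition `(0; 1^s)`. -/
def SuperPartition.zeroOnes (s : ℕ) : SuperPartition where
  antisym := [0]
  sym := List.replicate s 1
  antisym_strict := by simp
  sym_antitone := by simp [List.pairwise_replicate]
  sym_pos := by simp

/-- The elementary symmetric function `ẽ_s = m_{(0; 1^s)}` in superspace. -/
def elemTilde (s : ℕ) : ∀ N, SuperPoly k N := monomialSym k (SuperPartition.zeroOnes s)

end SymmetricFunctions

section ChromaticHopfSuperalgebra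

theorem ncard_preimage_equiv {α β : Type*} (e : α ≃ β) (W : Set β) :
    (e ⁻¹' W).ncard = W.ncard :=
  Set.ncard_preimage_of_injective_subset_range e.injective (by simp)

/-- Connected two-coloured graphs `(V, W, E)` with vertex set `V = Fin n` and set `W` of white
vertices, at most one vertex being white. -/
structure ConnTriple where
  n : ℕ
  graph : SimpleGraph (Fin n)
  white : Set (Fin n)
  connected : graph.Connected
  white_le : white.ncard ≤ 1

/-- Isomorphism of two-coloured graphs. -/
def ConnTriple.Iso (G H : ConnTriple) : Prop :=
  ∃ e : G.graph ≃g H.graph, ∀ v, e v ∈ H.white ↔ v ∈ G.white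

/-- `# W`. -/
def ConnTriple.numWhite (G : ConnTriple) : ℕ := G.white.ncard

/-- `# (V \ W)`. -/
def ConnTriple.numBlack (G : ConnTriple) : ℕ := G.whiteᶜ.ncard

/-- A connected two-coloured graph on any finite vertex set, transported to `Fin n`. -/
def ConnTriple.mk' {V : Type*} [Finite V] (Γ : SimpleGraph V) (W : Set V) (hΓ : Γ.Connected)
    (hW : W.ncard ≤ 1) : ConnTriple where
  n := Nat.card V
  graph := Γ.comap (Finite.equivFin V).symm
  white := (Finite.equivFin V).symm ⁻¹' W
  connected := (SimpleGraph.Iso.comap (Finite.equivFin V).symm Γ).connected_iff.2 hΓ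
  white_le := (ncard_preimage_equiv (Finite.equivFin V).symm W).le.trans hW

theorem ConnTriple.mk'_numWhite {V : Type*} [Finite V] (Γ : SimpleGraph V) (W : Set V)
    (hΓ : Γ.Connected) (hW : W.ncard ≤ 1) : (mk' Γ W hΓ hW).numWhite = W.ncard :=
  ncard_preimage_equiv (Finite.equivFin V).symm W

theorem ConnTriple.Iso.numWhite_eq {G H : ConnTriple} (h : G.Iso H) :
    G.numWhite = H.numWhite := by
  obtain ⟨e, he⟩ := h
  have : G.white = e.toEquiv ⁻¹' H.white := by ext v; exact (he v).symm
  rw [numWhite, this, ncard_preimage_equiv]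
  rfl

theorem ConnTriple.mk'_iso {V V' : Type*} [Finite V] [Finite V'] {Γ : SimpleGraph V}
    {Γ' : SimpleGraph V'} {W : Set V} {W' : Set V'} (hΓ : Γ.Connected) (hW : W.ncard ≤ 1)
    (hΓ' : Γ'.Connected) (hW' : W'.ncard ≤ 1) (e : Γ ≃g Γ') (he : ∀ v, e v ∈ W' ↔ v ∈ W) :
    (mk' Γ W hΓ hW).Iso (mk' Γ' W' hΓ' hW') := by
  refine ⟨((SimpleGraph.Iso.comap (Finite.equivFin V).symm Γ).trans e).trans
    (SimpleGraph.Iso.comap (Finite.equivFin V').symm Γ').symm, fun v => ?_⟩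
  have h : (Finite.equivFin V').symm ((((SimpleGraph.Iso.comap (Finite.equivFin V).symm Γ).trans
      e).trans (SimpleGraph.Iso.comap (Finite.equivFin V').symm Γ').symm) v) =
      e ((Finite.equivFin V).symm v) :=
    (SimpleGraph.Iso.comap (Finite.equivFin V').symm Γ').apply_symm_apply _
  change (Finite.equivFin V').symm _ ∈ W' ↔ (Finite.equivFin V).symm v ∈ W
  rw [← he ((Finite.equivFin V).symm v), ← h]
  rfl

variable (k : Type u) [Field k]

/-- The relations of the chromatic Hopf superalgebra. The free algebra has as a basis the words
`G_1 | ⋯ | G_l` in connected two-coloured graphs; isomorphic graphs are identified, and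
`[G | H] = (-1)^{# W_G # W_H} [H | G]`. -/
inductive ChromRel : FreeAlgebra k ConnTriple → FreeAlgebra k ConnTriple → Prop
  | iso (G H : ConnTriple) (h : G.Iso H) : ChromRel (FreeAlgebra.ι k G) (FreeAlgebra.ι k H)
  | comm (G H : ConnTriple) : ChromRel (FreeAlgebra.ι k G * FreeAlgebra.ι k H)
      ((-1 : k) ^ (G.numWhite * H.numWhite) • (FreeAlgebra.ι k H * FreeAlgebra.ι k G))

/-- The chromatic Hopf superalgebra `𝓖`, spanned by the two-coloured graphs all of whose connected
components have at most one white vertex (the comultiplication below is well defined and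
coassociative on these). -/
def Chrom : Type u := RingQuot (ChromRel k)

instance : Ring (Chrom k) := inferInstanceAs (Ring (RingQuot (ChromRel k)))
instance : Algebra k (Chrom k) := inferInstanceAs (Algebra k (RingQuot (ChromRel k)))

namespace Chrom

/-- The class `[G]` of a connected two-coloured graph. -/
def gen (G : ConnTriple) : Chrom k := RingQuot.mkAlgHom k (ChromRel k) (FreeAlgebra.ι k G)

/-- The class `[G_1 | ⋯ | G_l] = [G_1] ⋯ [G_l]`. -/
def word (l : List ConnTriple) : Chrom k := (l.map (gen k)).prod

theorem gen_iso {G H : ConnTriple} (h : G.Iso H) : gen k G = gen k H :=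
  RingQuot.mkAlgHom_rel k (ChromRel.iso G H h)

theorem gen_comm (G H : ConnTriple) :
    gen k G * gen k H = (-1 : k) ^ (G.numWhite * H.numWhite) • (gen k H * gen k G) := by
  have := RingQuot.mkAlgHom_rel k (ChromRel.comm (k := k) G H)
  rw [map_mul, map_smul, map_mul] at this
  exact this

variable {k} in
/-- The universal property of `𝓖`. -/
def lift {A : Type*} [Ring A] [Algebra k A] (f : ConnTriple → A)
    (hiso : ∀ G H, G.Iso H → f G = f H)
    (hcomm : ∀ G H, f G * f H = (-1 : k) ^ (G.numWhite * H.numWhite) • (f H * f G)) :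
    Chrom k →ₐ[k] A :=
  RingQuot.liftAlgHom k ⟨FreeAlgebra.lift k f, by
    rintro _ _ (⟨G, H, h⟩ | ⟨G, H⟩)
    · simpa using hiso G H h
    · simpa using hcomm G H⟩

variable {k} in
@[simp]
theorem lift_gen {A : Type*} [Ring A] [Algebra k A] (f : ConnTriple → A) (hiso hcomm)
    (G : ConnTriple) : lift (k := k) f hiso hcomm (gen k G) = f G := by
  simp only [lift, gen]
  erw [RingQuot.liftAlgHom_mkAlgHom_apply]
  simp

variable {k} in
theorem hom_ext {A : Type*} [Ring A] [Algebra k A] {f g : Chrom k →ₐ[k] A}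
    (h : ∀ G, f (gen k G) = g (gen k G)) : f = g := by
  apply RingQuot.ringQuot_ext'
  apply FreeAlgebra.hom_ext
  funext G
  exact h G

/-- `𝓖_{n,m}`, spanned by the classes with `n` black and `m` white vertices. -/
def bidegreePart (n m : ℕ) : Submodule k (Chrom k) :=
  Submodule.span k {a | ∃ l : List ConnTriple, (l.map ConnTriple.numBlack).sum = n ∧
    (l.map ConnTriple.numWhite).sum = m ∧ word k l = a}

/-- `𝓖^d = ⨁_{n+m=d} 𝓖_{n,m}`. -/
def degreePart (d : ℕ) : Submodule k (Chrom k) :=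
  ⨆ p : {p : ℕ × ℕ // p.1 + p.2 = d}, bidegreePart k p.1.1 p.1.2

/-- The even and odd part of `𝓖`, according to the number of white vertices modulo `2`. -/
def parityPart (p : ZMod 2) : Submodule k (Chrom k) :=
  Submodule.span k {a | ∃ l : List ConnTriple,
    ((l.map ConnTriple.numWhite).sum : ZMod 2) = p ∧ word k l = a}

theorem gen_mem_parityPart (G : ConnTriple) : gen k G ∈ parityPart k (G.numWhite : ZMod 2) :=
  Submodule.subset_span ⟨[G], by simp, by simp [word]⟩

instance : SetLike.GradedMonoid (parityPart k) where
  one_mem := Submodule.subset_span ⟨[], by simp, by simp [word]⟩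
  mul_mem p q a b ha hb := by
    have key : parityPart k p * parityPart k q ≤ parityPart k (p + q) := by
      rw [parityPart, parityPart, Submodule.span_mul_span, Submodule.span_le]
      rintro _ ⟨_, ⟨l, hl, rfl⟩, _, ⟨l', hl', rfl⟩, rfl⟩
      exact Submodule.subset_span ⟨l ++ l', by simp [← hl, ← hl'], by simp [word]⟩
    exact key (Submodule.mul_mem_mul ha hb)

/-- The homogeneous component map used to show that `𝓖` is the direct sum of its even and odd
part. -/
def toDirectSum : Chrom k →ₐ[k] ⨁ p, parityPart k p :=
  lift (fun G => DirectSum.of (fun p => parityPart k p) (G.numWhite : ZMod 2)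
      ⟨gen k G, gen_mem_parityPart k G⟩)
    (fun G H h => by
      apply DirectSum.of_eq_of_gradedMonoid_eq
      exact Sigma.subtype_ext (congrArg Nat.cast h.numWhite_eq) (gen_iso k h))
    (fun G H => by
      rw [DirectSum.of_mul_of, DirectSum.of_mul_of, ← DirectSum.lof_eq_of k,
        ← DirectSum.lof_eq_of k, ← map_smul, DirectSum.lof_eq_of, DirectSum.lof_eq_of]
      apply DirectSum.of_eq_of_gradedMonoid_eq
      refine Sigma.subtype_ext (add_comm _ _) ?_
      exact gen_comm k G H)

theorem toDirectSum_word (l : List ConnTriple) : ∀ (p : ZMod 2)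
    (_ : ((l.map ConnTriple.numWhite).sum : ZMod 2) = p) (h : word k l ∈ parityPart k p),
    toDirectSum k (word k l) = DirectSum.of (fun p => parityPart k p) p ⟨word k l, h⟩ := by
  induction l with
  | nil =>
    rintro p rfl h
    simp only [word, List.map_nil, List.prod_nil, map_one]
    rw [DirectSum.one_def]
    apply DirectSum.of_eq_of_gradedMonoid_eq
    exact Sigma.subtype_ext (by
      change (0 : ZMod 2) = (([] : List ℕ).sum : ℕ)
      simp) rfl
  | cons G l ih =>
    rintro p rfl h
    have h' : word k l ∈ parityPart k ((l.map ConnTriple.numWhite).sum : ZMod 2) :=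
      Submodule.subset_span ⟨l, rfl, rfl⟩
    have hw : word k (G :: l) = gen k G * word k l := by simp [word]
    conv_lhs => rw [hw]
    rw [map_mul, ih _ rfl h', toDirectSum, lift_gen, DirectSum.of_mul_of]
    apply DirectSum.of_eq_of_gradedMonoid_eq
    exact Sigma.subtype_ext (by
      change (_ + _ : ZMod 2) = (((G :: l).map ConnTriple.numWhite).sum : ℕ)
      rw [List.map_cons, List.sum_cons, Nat.cast_add]) hw.symm

instance : GradedAlgebra (parityPart k) :=
  GradedAlgebra.ofAlgHom (parityPart k) (toDirectSum k)
    (hom_ext fun G => by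
      simp only [AlgHom.comp_apply, toDirectSum, lift_gen, AlgHom.id_apply]
      exact DirectSum.coeAlgHom_of _ _ _)
    (by
      rintro p ⟨x, hx⟩
      dsimp only
      induction hx using Submodule.span_induction with
      | mem x h =>
        obtain ⟨l, hl, rfl⟩ := h
        exact toDirectSum_word k l p hl _
      | zero => rw [map_zero]; exact (map_zero _).symm
      | add x y hx hy ihx ihy =>
        rw [map_add, ihx, ihy, ← map_add]; rfl
      | smul c x hx ih =>
        rw [map_smul, ih, ← DirectSum.lof_eq_of k, ← map_smul]; rfl)

theorem neg_one_pow_smul {M : Type*} [AddCommGroup M] [Module k M] (n m : ℕ) (x : M) :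
    (-1 : k) ^ (n * m) • x = (-1 : ℤˣ) ^ ((n : ZMod 2) * (m : ZMod 2)) • x := by
  rw [← Nat.cast_mul, uzpow_natCast]
  rcases Nat.even_or_odd (n * m) with h | h
  · simp [h.neg_one_pow]
  · simp [h.neg_one_pow]

theorem gen_mul_word (G : ConnTriple) (l : List ConnTriple) :
    gen k G * word k l = (-1 : ℤˣ) ^ ((G.numWhite : ZMod 2) *
      ((l.map ConnTriple.numWhite).sum : ZMod 2)) • (word k l * gen k G) := by
  induction l with
  | nil => simp [word]
  | cons H l ih =>
    have hw : word k (H :: l) = gen k H * word k l := by simp [word]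
    rw [hw, ← mul_assoc, gen_comm, neg_one_pow_smul, smul_mul_assoc, mul_assoc, ih,
      mul_smul_comm, smul_smul, ← uzpow_add, mul_assoc]
    congr 2
    simp [mul_add]

theorem word_mul_word (l l' : List ConnTriple) :
    word k l * word k l' = (-1 : ℤˣ) ^ (((l.map ConnTriple.numWhite).sum : ZMod 2) *
      ((l'.map ConnTriple.numWhite).sum : ZMod 2)) • (word k l' * word k l) := by
  induction l with
  | nil => simp [word]
  | cons H l ih =>
    have hw : word k (H :: l) = gen k H * word k l := by simp [word]
    rw [hw, mul_assoc, ih, mul_smul_comm, ← mul_assoc, gen_mul_word, smul_mul_assoc, smul_smul,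
      ← uzpow_add, mul_assoc]
    congr 2
    simp [add_mul, add_comm]

/-- `𝓖` is a commutative superalgebra. -/
theorem supercomm {p q : ZMod 2} {a b : Chrom k} (ha : a ∈ parityPart k p)
    (hb : b ∈ parityPart k q) : a * b = (-1 : ℤˣ) ^ (p * q) • (b * a) := by
  induction ha using Submodule.span_induction with
  | zero => simp
  | add x y _ _ hx hy => simp only [add_mul, mul_add, hx, hy, smul_add]
  | smul c x _ hx => rw [smul_mul_assoc, hx, mul_smul_comm, smul_comm]
  | mem x hx =>
    obtain ⟨l, rfl, rfl⟩ := hx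
    induction hb using Submodule.span_induction with
    | zero => simp
    | add x y _ _ hx hy => simp only [add_mul, mul_add, hx, hy, smul_add]
    | smul c x _ hx => rw [mul_smul_comm, hx, smul_mul_assoc, smul_comm]
    | mem x hx =>
      obtain ⟨l', rfl, rfl⟩ := hx
      exact word_mul_word k l l'

/-- The elements of the graded tensor product of total parity `p`. -/
def tensorParity (p : ZMod 2) : Submodule k (parityPart k ᵍ⊗[k] parityPart k) :=
  Submodule.span k {t | ∃ (i j : ZMod 2) (a b : Chrom k), a ∈ parityPart k i ∧
    b ∈ parityPart k j ∧ i + j = p ∧ t = a ᵍ⊗ₜ[k] b}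

theorem units_smul_tmul (u v : ℤˣ) (a b : Chrom k) :
    ((u • a) ᵍ⊗ₜ[k] (v • b) : parityPart k ᵍ⊗[k] parityPart k) = (u * v) • (a ᵍ⊗ₜ[k] b) := by
  rcases Int.units_eq_one_or u with rfl | rfl <;> rcases Int.units_eq_one_or v with rfl | rfl
  · simp
  · simpa using (congrArg (GradedTensorProduct.of k (parityPart k) (parityPart k))
      (TensorProduct.tmul_neg a b)).trans (map_neg _ _)
  · simpa using (congrArg (GradedTensorProduct.of k (parityPart k) (parityPart k))
      (TensorProduct.neg_tmul a b)).trans (map_neg _ _)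
  · simp [TensorProduct.neg_tmul, TensorProduct.tmul_neg]

theorem sign_exponent : ∀ i j i' j' : ZMod 2,
    j * i' + (i * i' + j * j') = (i + j) * (i' + j') + j' * i := by
  decide

theorem tensor_supercomm {p q : ZMod 2} {s t : parityPart k ᵍ⊗[k] parityPart k}
    (hs : s ∈ tensorParity k p) (ht : t ∈ tensorParity k q) :
    s * t = (-1 : ℤˣ) ^ (p * q) • (t * s) := by
  induction hs using Submodule.span_induction with
  | zero => simp
  | add x y _ _ hx hy => simp only [add_mul, mul_add, hx, hy, smul_add]
  | smul c x _ hx => rw [smul_mul_assoc, hx, mul_smul_comm, smul_comm]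
  | mem x hx =>
    obtain ⟨i, j, a, b, ha, hb, rfl, rfl⟩ := hx
    induction ht using Submodule.span_induction with
    | zero => simp
    | add x y _ _ hx hy => simp only [add_mul, mul_add, hx, hy, smul_add]
    | smul c x _ hx => rw [mul_smul_comm, hx, smul_mul_assoc, smul_comm]
    | mem x hx =>
      obtain ⟨i', j', c, d, hc, hd, rfl, rfl⟩ := hx
      rw [GradedTensorProduct.tmul_coe_mul_coe_tmul (parityPart k) (parityPart k) a ⟨b, hb⟩
        ⟨c, hc⟩ d, GradedTensorProduct.tmul_coe_mul_coe_tmul (parityPart k) (parityPart k) c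
        ⟨d, hd⟩ ⟨a, ha⟩ b]
      dsimp only
      rw [supercomm k ha hc, supercomm k hb hd, units_smul_tmul, smul_smul, smul_smul,
        ← uzpow_add, ← uzpow_add, ← uzpow_add, sign_exponent]

theorem comp_white_le {V : Type*} [Finite V] (Γ : SimpleGraph V) (W : Set V) (hW : W.ncard ≤ 1)
    (c : Γ.ConnectedComponent) : ((Subtype.val : c → V) ⁻¹' W).ncard ≤ 1 := by
  refine le_trans ?_ hW
  rw [← Set.ncard_image_of_injective _ Subtype.val_injective]
  exact Set.ncard_le_ncard (Set.image_preimage_subset _ _) (Set.toFinite _)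

/-- A connected component of a two-coloured graph. -/
def component {V : Type*} [Finite V] (Γ : SimpleGraph V) (W : Set V) (hW : W.ncard ≤ 1)
    (c : Γ.ConnectedComponent) : ConnTriple :=
  ConnTriple.mk' c.toSimpleGraph ((Subtype.val : c → V) ⁻¹' W) c.connected_toSimpleGraph
    (comp_white_le Γ W hW c)

theorem component_numWhite {V : Type*} [Finite V] (Γ : SimpleGraph V) (W : Set V)
    (hW : W.ncard ≤ 1) (c : Γ.ConnectedComponent) :
    (component Γ W hW c).numWhite = (W ∩ {v | Γ.connectedComponentMk v = c}).ncard := by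
  rw [component, ConnTriple.mk'_numWhite, ← Set.ncard_image_of_injective _ Subtype.val_injective]
  congr 1
  ext v
  constructor
  · rintro ⟨⟨v, hv⟩, h, rfl⟩
    exact ⟨h, hv⟩
  · rintro ⟨h, hv⟩
    exact ⟨⟨v, hv⟩, h, rfl⟩

open Classical in
theorem sum_component_numWhite {V : Type*} [Finite V] (Γ : SimpleGraph V) (W : Set V)
    (hW : W.ncard ≤ 1) [Fintype Γ.ConnectedComponent] :
    ∑ c, (component Γ W hW c).numWhite = W.ncard := by
  have := Fintype.ofFinite V
  simp only [component_numWhite]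
  rw [Set.ncard_eq_toFinset_card' W, Finset.card_eq_sum_card_fiberwise (t := Finset.univ)
    (f := Γ.connectedComponentMk) (by simp)]
  refine Finset.sum_congr rfl fun c _ => ?_
  rw [Set.ncard_eq_toFinset_card']
  congr 1
  ext v
  simp

theorem component_comm {V : Type*} [Finite V] (Γ : SimpleGraph V) (W : Set V)
    (hW : W.ncard ≤ 1) (s : Set Γ.ConnectedComponent) :
    s.Pairwise (Function.onFun Commute fun c => gen k (component Γ W hW c)) := by
  classical
  intro c _ d _ hcd
  have := Fintype.ofFinite Γ.ConnectedComponent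
  have h1 := sum_component_numWhite Γ W hW
  have h2 : (component Γ W hW c).numWhite + (component Γ W hW d).numWhite ≤ W.ncard := by
    rw [← h1, ← Finset.sum_pair hcd (f := fun c => (component Γ W hW c).numWhite)]
    exact Finset.sum_le_sum_of_subset (Finset.subset_univ _)
  have h3 : (component Γ W hW c).numWhite * (component Γ W hW d).numWhite = 0 := by
    rw [Nat.mul_eq_zero]; omega
  have := gen_comm k (component Γ W hW c) (component Γ W hW d)
  rwa [h3, pow_zero, one_smul] at this

open Classical in
/-- The class `[G]` of a two-coloured graph `G` with at most one white vertex: the product of the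
classes of its connected components. The order of the components is irrelevant, because at most
one of them contains a white vertex. -/
def cls {V : Type*} [Finite V] (Γ : SimpleGraph V) (W : Set V) (hW : W.ncard ≤ 1) : Chrom k :=
  letI := Fintype.ofFinite Γ.ConnectedComponent
  Finset.univ.noncommProd (fun c => gen k (component Γ W hW c)) (component_comm k Γ W hW _)

theorem cls_mem_parityPart {V : Type*} [Finite V] (Γ : SimpleGraph V) (W : Set V)
    (hW : W.ncard ≤ 1) : cls k Γ W hW ∈ parityPart k (W.ncard : ZMod 2) := by
  classical
  let _ := Fintype.ofFinite Γ.ConnectedComponent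
  refine Submodule.subset_span
    ⟨(Finset.univ : Finset Γ.ConnectedComponent).toList.map (component Γ W hW), ?_, ?_⟩
  · rw [List.map_map, Finset.sum_map_toList, ← sum_component_numWhite Γ W hW]
    rfl
  · have := Finset.noncommProd_toFinset (Finset.univ : Finset Γ.ConnectedComponent).toList
      (fun c => gen k (component Γ W hW c)) (component_comm k Γ W hW _) (Finset.nodup_toList _)
    simp only [word, List.map_map, cls, Function.comp_def]
    rw [← this]
    congr 1
    simp

theorem cls_iso {V V' : Type*} [Finite V] [Finite V'] {Γ : SimpleGraph V} {Γ' : SimpleGraph V'}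
    {W : Set V} {W' : Set V'} (hW : W.ncard ≤ 1) (hW' : W'.ncard ≤ 1) (e : Γ ≃g Γ')
    (he : ∀ v, e v ∈ W' ↔ v ∈ W) : cls k Γ W hW = cls k Γ' W' hW' := by
  classical
  let _ := Fintype.ofFinite Γ.ConnectedComponent
  let _ := Fintype.ofFinite Γ'.ConnectedComponent
  have h : ∀ c, gen k (component Γ W hW c) =
      gen k (component Γ' W' hW' (e.connectedComponentEquiv c)) := fun c =>
    gen_iso k (ConnTriple.mk'_iso _ _ _ _
      ⟨SimpleGraph.ConnectedComponent.isoEquivSupp e c, fun {a b} => e.map_adj_iff⟩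
      fun v => he v)
  unfold cls Finset.noncommProd
  congr 1
  simp only [h]
  rw [← Finset.map_univ_equiv e.connectedComponentEquiv, Finset.map_val, Multiset.map_map]
  rfl

/-- The class `[G|_S]` of the restriction of `G` to a set `S` of vertices. -/
def restrict (G : ConnTriple) (S : Set (Fin G.n)) : Chrom k :=
  cls k (G.graph.induce S) ((Subtype.val : S → Fin G.n) ⁻¹' G.white) (by
    refine le_trans ?_ G.white_le
    rw [← Set.ncard_image_of_injective _ Subtype.val_injective]
    exact Set.ncard_le_ncard (Set.image_preimage_subset _ _) (Set.toFinite _))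

theorem restrict_mem (G : ConnTriple) (S : Set (Fin G.n)) :
    restrict k G S ∈ parityPart k ((G.white ∩ S).ncard : ZMod 2) := by
  have h : ((Subtype.val : S → Fin G.n) ⁻¹' G.white).ncard = (G.white ∩ S).ncard := by
    rw [← Set.ncard_image_of_injective _ Subtype.val_injective, Subtype.image_preimage_coe,
      Set.inter_comm]
  rw [← h]
  exact cls_mem_parityPart k _ _ _

open Classical in
/-- The comultiplication on a connected two-coloured graph,
`½ ∑_{V = V₁ ⊔ V₂} ([G|_{V₁}] ⊗ [G|_{V₂}] + (-1)^{# W₁ # W₂} [G|_{V₂}] ⊗ [G|_{V₁}])`. -/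
def comulGen (G : ConnTriple) : parityPart k ᵍ⊗[k] parityPart k :=
  (2 : k)⁻¹ • ∑ S : Set (Fin G.n),
    (restrict k G S ᵍ⊗ₜ[k] restrict k G Sᶜ +
      (-1 : k) ^ ((G.white ∩ S).ncard * (G.white ∩ Sᶜ).ncard) •
        (restrict k G Sᶜ ᵍ⊗ₜ[k] restrict k G S))

theorem restrict_iso {G H : ConnTriple} (e : G.graph ≃g H.graph)
    (he : ∀ v, e v ∈ H.white ↔ v ∈ G.white) (S : Set (Fin G.n)) (T : Set (Fin H.n))
    (hT : ∀ v, e v ∈ T ↔ v ∈ S) : restrict k G S = restrict k H T := by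
  refine cls_iso k _ _ ⟨e.toEquiv.subtypeEquiv fun v => (hT v).symm, fun {a b} => ?_⟩
    fun v => he v
  exact e.map_adj_iff

theorem comulGen_iso {G H : ConnTriple} (h : G.Iso H) : comulGen k G = comulGen k H := by
  classical
  obtain ⟨e, he⟩ := h
  unfold comulGen
  congr 1
  refine Fintype.sum_equiv (Equiv.Set.congr e.toEquiv) _ _ fun S => ?_
  have h1 : ∀ v, e v ∈ Equiv.Set.congr e.toEquiv S ↔ v ∈ S := fun v => by
    simp [Equiv.Set.congr]
  have hc : ∀ (S : Set (Fin G.n)) (T : Set (Fin H.n)), (∀ v, e v ∈ T ↔ v ∈ S) →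
      (G.white ∩ S).ncard = (H.white ∩ T).ncard := fun S T hT => by
    rw [← ncard_preimage_equiv e.toEquiv (H.white ∩ T)]
    congr 1
    ext v
    exact (and_congr (he v) (hT v)).symm
  have h2 : ∀ v, e v ∈ (Equiv.Set.congr e.toEquiv S)ᶜ ↔ v ∈ Sᶜ := fun v => not_congr (h1 v)
  rw [restrict_iso k e he _ _ h1, restrict_iso k e he _ _ h2, hc _ _ h1, hc _ _ h2]

theorem comulGen_mem (G : ConnTriple) :
    comulGen k G ∈ tensorParity k (G.numWhite : ZMod 2) := by
  classical
  have hc : ∀ S : Set (Fin G.n), ((G.white ∩ S).ncard : ZMod 2) + ((G.white ∩ Sᶜ).ncard : ZMod 2) =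
      G.numWhite := fun S => by
    rw [← Nat.cast_add, ← Set.ncard_union_eq]
    · rw [Set.inter_union_compl]; rfl
    · exact Set.disjoint_left.2 fun v hv hv' => hv'.2 hv.2
  refine Submodule.smul_mem _ _ (Submodule.sum_mem _ fun S _ => Submodule.add_mem _ ?_
    (Submodule.smul_mem _ _ ?_))
  · exact Submodule.subset_span ⟨_, _, _, _, restrict_mem k G S, restrict_mem k G Sᶜ, hc S, rfl⟩
  · exact Submodule.subset_span
      ⟨_, _, _, _, restrict_mem k G Sᶜ, restrict_mem k G S, (add_comm _ _).trans (hc S), rfl⟩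

/-- The comultiplication of `𝓖`, the morphism of superalgebras from `𝓖` to the super tensor product
`𝓖 ⊗ 𝓖`, with `(a ⊗ b)(c ⊗ d) = (-1)^{|b||c|} ac ⊗ bd`, given by `comulGen` on connected
two-coloured graphs. -/
def comul : Chrom k →ₐ[k] parityPart k ᵍ⊗[k] parityPart k :=
  lift (comulGen k) (fun _ _ h => comulGen_iso k h) (fun G H => by
    rw [neg_one_pow_smul]
    exact tensor_supercomm k (comulGen_mem k G) (comulGen_mem k H))

/-- The counit of `𝓖`, with `[∅] ↦ 1` and `[G] ↦ 0` for nonempty `G`. -/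
def counit : Chrom k →ₐ[k] k :=
  lift (fun _ => 0) (fun _ _ _ => rfl) (fun _ _ => by simp)

open Classical in
/-- The value of the supercharacter `ζ_ch` on a connected two-coloured graph. -/
def zetaGen (G : ConnTriple) : DualNumber k :=
  if G.graph.edgeSet = ∅ ∧ G.numWhite = 0 then 1
  else if G.graph.edgeSet = ∅ ∧ G.numWhite = 1 then DualNumber.eps
  else 0

/-- The supercharacter `ζ_ch : 𝓖 → k[ε]`. -/
def zetaCh : Chrom k →ₐ[k] DualNumber k :=
  lift (zetaGen k)
    (fun G H h => by
      have h1 := h.numWhite_eq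
      obtain ⟨e, -⟩ := h
      have h2 : G.graph.edgeSet = ∅ ↔ H.graph.edgeSet = ∅ := by
        rw [SimpleGraph.edgeSet_eq_empty, SimpleGraph.edgeSet_eq_empty,
          SimpleGraph.eq_bot_iff_forall_not_adj, SimpleGraph.eq_bot_iff_forall_not_adj]
        refine ⟨fun h a b hab => h (e.symm a) (e.symm b) (e.symm.map_adj_iff.2 hab),
          fun h a b hab => h (e a) (e b) (e.map_adj_iff.2 hab)⟩
      simp only [zetaGen, h1, h2])
    (fun G H => by
      have := G.white_le
      have := H.white_le
      unfold zetaGen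
      split_ifs <;> simp_all)

end Chrom

/-- Graded even morphisms `Ψ : 𝓖 → 𝚲` of Hopf superalgebras with `ζ_S ∘ Ψ = ζ_ch`. (Compatibility
with the antipodes is automatic for morphisms of bialgebras.) -/
structure IsChromaticMorphism (Ψ : Chrom k →ₐ[k] SymFun k) : Prop where
  map_degree : ∀ d, ∀ a ∈ Chrom.degreePart k d, Ψ a ∈ SymFun.degreePart k d
  map_parity : ∀ p, ∀ a ∈ Chrom.parityPart k p, Ψ a ∈ SymFun.parityPart k p
  map_comul : ∀ a, SymFun.IsComul k (Ψ a) (TensorProduct.map Ψ.toLinearMap Ψ.toLinearMap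
    ((GradedTensorProduct.of k (Chrom.parityPart k) (Chrom.parityPart k)).symm (Chrom.comul k a)))
  map_counit : ∀ a, (Ψ a).1 0 = algebraMap k (SuperPoly k 0) (Chrom.counit k a)
  map_zeta : ∀ a, zetaS k (Ψ a) = Chrom.zetaCh k a

end ChromaticHopfSuperalgebra

end SuperChromatic

end

/-! A symmetric function in superspace is a compatible family of polynomials in `N` supervariables,
so everything can be checked for each `N`.

Uniqueness: `N = 0` is governed by the counit. For `N = 1`, the part of degree `d` is spanned by
`x^d` and `x^(d-1) θ`, which specialize to `1` and `ε`; hence degree and supercharacter determine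
the value on every graph (`zetaSection_zetaOne`). The comultiplication expresses the polynomial in
`N + 1` supervariables through those in `N` and in `1`, so induction on `N` finishes
(`IsChromaticMorphism.unique`).

Existence: send a connected graph to the sum over proper colourings `κ` of the product of `x_{κ v}`
over black `v` and `θ_{κ w}` over white `w`. With at most one white vertex no product of two odd
variables occurs. The sum is therefore formed in a commutative ring `TruncPoly`, where odd variables
multiply to zero, and carried to `k[x, θ]_N` by the linear map `toSuper`, which respects products
having a factor without `θ`. Each property of the morphism is then a fact about colourings.
Components are coloured independently (`coloringSum_components`). Colouring by `α ⊕ β` splits the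
vertices into two sets (`coloringSum_sum`), which is the comultiplication. One colour suffices only
if there are no edges (`coloringSum_of_subsingleton`), which is `ζ_ch`.

Complete graph: proper colourings are injections. Each injection comes from `(N - n - 1)!`
permutations in the symmetrization defining `m_{(0;1^n)}`, whose normalization is `1 / (n! (N - n -
1)!)`; the factor `n!` remains (`sum_embedding_eq_elemTilde`). -/

noncomputable section

namespace SuperChromatic

open scoped TensorProduct DirectSum

universe u

/-! ### Weighted sums over proper colourings -/

section ColoringSum

variable {R : Type*} [CommRing R] {V : Type*} [Finite V] {α β : Type*} [Finite α] [Finite β]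

open Classical in
/-- The weighted sum over the proper colourings `κ` of a two-coloured graph `(V, W, E)`: a white
vertex `v` has weight `t (κ v)`, a black one `x (κ v)`. -/
def coloringSum (Γ : SimpleGraph V) (W : Set V) (x t : α → R) : R :=
  letI := Fintype.ofFinite V
  letI := Fintype.ofFinite (Γ.Coloring α)
  ∑ κ : Γ.Coloring α, ∏ v, if v ∈ W then t (κ v) else x (κ v)

open Classical in
theorem coloringSum_def [Fintype V] (Γ : SimpleGraph V) [Fintype (Γ.Coloring α)] (W : Set V)
    (x t : α → R) :
    coloringSum Γ W x t = ∑ κ : Γ.Coloring α, ∏ v, if v ∈ W then t (κ v) else x (κ v) := by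
  unfold coloringSum
  congr!

theorem map_coloringSum {S F : Type*} [CommRing S] [FunLike F R S] [RingHomClass F R S] (f : F)
    (Γ : SimpleGraph V) (W : Set V) (x t : α → R) :
    f (coloringSum Γ W x t) = coloringSum Γ W (fun i => f (x i)) (fun i => f (t i)) := by
  classical
  have := Fintype.ofFinite V
  have := Fintype.ofFinite (Γ.Coloring α)
  simp only [coloringSum_def, map_sum, map_prod, apply_ite f]

theorem coloringSum_iso {V' : Type*} [Finite V'] {Γ : SimpleGraph V} {Γ' : SimpleGraph V'}
    {W : Set V} {W' : Set V'} (e : Γ ≃g Γ') (he : ∀ v, e v ∈ W' ↔ v ∈ W) (x t : α → R) :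
    coloringSum Γ W x t = coloringSum Γ' W' x t := by
  classical
  have := Fintype.ofFinite V
  have := Fintype.ofFinite V'
  have := Fintype.ofFinite (Γ.Coloring α)
  have := Fintype.ofFinite (Γ'.Coloring α)
  simp only [coloringSum_def]
  refine Fintype.sum_equiv (SimpleGraph.coloringCongr e (Equiv.refl α)) _ _ fun κ => ?_
  refine Fintype.prod_equiv e.toEquiv _ _ fun v => ?_
  have h : (SimpleGraph.coloringCongr e (Equiv.refl α) κ) (e v) = κ v := by
    change κ (e.symm (e v)) = κ v
    rw [e.symm_apply_apply]
  change _ = if e v ∈ W' then t ((SimpleGraph.coloringCongr e (Equiv.refl α) κ) (e v)) else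
    x ((SimpleGraph.coloringCongr e (Equiv.refl α) κ) (e v))
  simp only [h, he]

/-- Colours of weight zero may be removed. -/
theorem coloringSum_embedding (Γ : SimpleGraph V) (W : Set V) (f : α ↪ β) (x t : β → R)
    (hx : ∀ b ∉ Set.range f, x b = 0) (ht : ∀ b ∉ Set.range f, t b = 0) :
    coloringSum Γ W (fun a => x (f a)) (fun a => t (f a)) = coloringSum Γ W x t := by
  classical
  have := Fintype.ofFinite V
  have := Fintype.ofFinite (Γ.Coloring α)
  have := Fintype.ofFinite (Γ.Coloring β)
  simp only [coloringSum_def]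
  refine Finset.sum_of_injOn (Γ.recolorOfEmbedding f) (Γ.recolorOfEmbedding f).injective.injOn
    (by simp) (fun κ _ hκ => ?_) (fun κ _ => by simp [SimpleGraph.coe_recolorOfEmbedding])
  -- A colouring that is not a recoloured `α`-colouring uses some colour outside the range of `f`,
  -- and that vertex contributes a zero factor.
  obtain ⟨v, hv⟩ : ∃ v, κ v ∉ Set.range f := by
    by_contra! h
    choose g hg using h
    refine hκ ⟨SimpleGraph.Coloring.mk g fun {v w} hvw hgvw => κ.valid hvw ?_, by simp, ?_⟩
    · rw [← hg v, ← hg w, hgvw]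
    · ext v
      exact hg v
  exact Finset.prod_eq_zero (Finset.mem_univ v) (by simp [hx _ hv, ht _ hv])

/-- Every edge lies inside one component, so a proper colouring is an independent choice of a proper
colouring on each component. -/
theorem coloringSum_components (Γ : SimpleGraph V) [Fintype Γ.ConnectedComponent] (W : Set V)
    (x t : α → R) : coloringSum Γ W x t =
      ∏ c : Γ.ConnectedComponent, coloringSum c.toSimpleGraph ((Subtype.val : c → V) ⁻¹' W) x t := by
  classical
  have := Fintype.ofFinite V
  have := Fintype.ofFinite (Γ.Coloring α)
  have (c : Γ.ConnectedComponent) := Fintype.ofFinite c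
  have (c : Γ.ConnectedComponent) := Fintype.ofFinite (c.toSimpleGraph.Coloring α)
  simp only [coloringSum_def, Fintype.prod_sum]
  refine Fintype.sum_bijective
    (fun κ c => SimpleGraph.Coloring.comap κ c.toSimpleGraph_hom) ⟨fun κ κ' h => ?_, fun κ => ?_⟩
    _ _ fun κ => ?_
  · ext v
    exact congrArg (fun g : (Γ.connectedComponentMk v).toSimpleGraph.Coloring α => g ⟨v, rfl⟩)
      (congrFun h (Γ.connectedComponentMk v))
  -- The components `c` and `d` are kept as separate variables so that their equality, forced by
  -- adjacency, can be substituted in the dependent family `κ`.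
  · have hadj : ∀ {v w : V}, Γ.Adj v w → ∀ (c d : Γ.ConnectedComponent) (hv : v ∈ c) (hw : w ∈ d),
        κ c ⟨v, hv⟩ ≠ κ d ⟨w, hw⟩ := by
      intro v w hvw c d hv hw
      obtain rfl : c = d := by
        rw [← hv, ← hw]
        exact SimpleGraph.ConnectedComponent.sound hvw.reachable
      exact (κ c).valid hvw
    refine ⟨SimpleGraph.Coloring.mk (fun v => κ (Γ.connectedComponentMk v) ⟨v, rfl⟩)
      fun {v w} hvw => hadj hvw _ _ _ _, ?_⟩
    funext c
    ext ⟨v, rfl⟩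
    rfl
  · rw [← (Equiv.sigmaFiberEquiv Γ.connectedComponentMk).prod_comp, Fintype.prod_sigma]
    exact Finset.prod_congr rfl fun c _ =>
      @Fintype.prod_equiv _ _ _ (_) (_) _ (Equiv.refl _) _ _ fun v => rfl

/-- Let `S` be the set of vertices coloured from `α`. An edge between `S` and its complement is
never monochromatic, so only the two induced subgraphs impose conditions. This is the combinatorial
source of the comultiplication. -/
theorem coloringSum_sum (Γ : SimpleGraph V) [Fintype (Set V)] (W : Set V) (x t : α ⊕ β → R) :
    coloringSum Γ W x t = ∑ S : Set V,
      coloringSum (Γ.induce S) ((Subtype.val : S → V) ⁻¹' W)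
        (fun a => x (Sum.inl a)) (fun a => t (Sum.inl a)) *
      coloringSum (Γ.induce Sᶜ) ((Subtype.val : ↥Sᶜ → V) ⁻¹' W)
        (fun b => x (Sum.inr b)) (fun b => t (Sum.inr b)) := by
  classical
  have := Fintype.ofFinite V
  have := Fintype.ofFinite (Γ.Coloring (α ⊕ β))
  have (S : Set V) := Fintype.ofFinite ((Γ.induce S).Coloring α)
  have (S : Set V) := Fintype.ofFinite ((Γ.induce S).Coloring β)
  simp only [coloringSum_def]
  rw [← Finset.sum_fiberwise (s := Finset.univ) (g := fun κ : Γ.Coloring (α ⊕ β) =>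
    {v | (κ v).isLeft})]
  refine Finset.sum_congr rfl fun S _ => ?_
  rw [Fintype.sum_mul_sum, ← Finset.sum_product']
  let glue (p : (Γ.induce S).Coloring α × (Γ.induce Sᶜ).Coloring β) (v : V) : α ⊕ β :=
    if h : v ∈ S then Sum.inl (p.1 ⟨v, h⟩) else Sum.inr (p.2 ⟨v, h⟩)
  have glue_pos : ∀ p v (h : v ∈ S), glue p v = Sum.inl (p.1 ⟨v, h⟩) := fun p v h => dif_pos h
  have glue_neg : ∀ p v (h : v ∉ S), glue p v = Sum.inr (p.2 ⟨v, h⟩) := fun p v h => dif_neg h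
  symm
  refine Finset.sum_bij (fun p _ => SimpleGraph.Coloring.mk (glue p) ?_) ?_ ?_ ?_ ?_
  · intro v w hvw
    by_cases hv : v ∈ S <;> by_cases hw : w ∈ S
    · rw [glue_pos p v hv, glue_pos p w hw, Ne, Sum.inl.injEq]
      exact p.1.valid (v := ⟨v, hv⟩) (w := ⟨w, hw⟩) hvw
    · simp [glue_pos p v hv, glue_neg p w hw]
    · simp [glue_neg p v hv, glue_pos p w hw]
    · rw [glue_neg p v hv, glue_neg p w hw, Ne, Sum.inr.injEq]
      exact p.2.valid (v := ⟨v, hv⟩) (w := ⟨w, hw⟩) hvw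
  · intro p _
    simp only [Finset.mem_filter, Finset.mem_univ, true_and]
    ext v
    change (glue p v).isLeft ↔ _
    by_cases hv : v ∈ S
    · simp [glue_pos p v hv, hv]
    · simp [glue_neg p v hv, hv]
  · intro p _ q _ h
    have h' : ∀ v, glue p v = glue q v := fun v => congrArg (fun κ : Γ.Coloring (α ⊕ β) => κ v) h
    refine Prod.ext ?_ ?_
    · ext ⟨v, hv⟩
      have := h' v
      rwa [glue_pos _ _ hv, glue_pos _ _ hv, Sum.inl.injEq] at this
    · ext ⟨v, hv⟩
      have := h' v
      rwa [glue_neg _ _ hv, glue_neg _ _ hv, Sum.inr.injEq] at this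
  · intro κ hκ
    simp only [Finset.mem_filter, Finset.mem_univ, true_and] at hκ
    have h1 : ∀ v : S, ∃ a, κ v = Sum.inl a := fun v => Sum.isLeft_iff.1 (by
      exact (Set.ext_iff.1 hκ v).2 v.2)
    have h2 : ∀ v : ↥Sᶜ, ∃ b, κ v = Sum.inr b := fun v => Sum.isRight_iff.1 (by
      simpa using fun h => v.2 ((Set.ext_iff.1 hκ v).1 h))
    choose f hf using h1
    choose g hg using h2
    refine ⟨(SimpleGraph.Coloring.mk f fun {v w} hvw h => κ.valid (v := v.1) (w := w.1) hvw ?_,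
      SimpleGraph.Coloring.mk g fun {v w} hvw h => κ.valid (v := v.1) (w := w.1) hvw ?_),
      by simp, ?_⟩
    · rw [hf, hf, h]
    · rw [hg, hg, h]
    · ext v
      change glue _ v = _
      by_cases hv : v ∈ S
      · rw [glue_pos _ _ hv]; exact (hf ⟨v, hv⟩).symm
      · rw [glue_neg _ _ hv]; exact (hg ⟨v, hv⟩).symm
  · intro p _
    rw [← Fintype.prod_subtype_mul_prod_subtype (fun v => v ∈ S)]
    congr 1
    · refine Finset.prod_congr rfl fun v _ => ?_
      change _ = if v.1 ∈ W then t (glue p v) else x (glue p v)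
      rw [glue_pos p v.1 v.2]
      rfl
    · refine Finset.prod_congr rfl fun v _ => ?_
      change _ = if v.1 ∈ W then t (glue p v) else x (glue p v)
      rw [glue_neg p v.1 v.2]
      rfl

end ColoringSum

/-! ### Supercommutativity, the commutative model `TruncPoly`, and chromatic polynomials -/

section SuperPolynomials

variable (k : Type u) [Field k]

/-- Moving one vector past `b` costs `m'` sign changes (`key`); moving the vectors of `a` one at a
time gives the total sign. -/
theorem exteriorPower_supercomm {M : Type*} [AddCommGroup M] [Module k M] {m m' : ℕ}
    {a b : ExteriorAlgebra k M} (ha : a ∈ ⋀[k]^m M) (hb : b ∈ ⋀[k]^m' M) :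
    a * b = (-1 : k) ^ (m * m') • (b * a) := by
  have key : ∀ v : M, b * ExteriorAlgebra.ι k v =
      (-1 : k) ^ m' • (ExteriorAlgebra.ι k v * b) := by
    intro v
    induction hb using Submodule.pow_induction_on_left' with
    | algebraMap r => simp [Algebra.commutes]
    | add x y i hx hy ihx ihy => simp only [add_mul, mul_add, ihx, ihy, smul_add]
    | mem_mul w hw i x hx ih =>
      obtain ⟨w, rfl⟩ := hw
      rw [mul_assoc, ih, mul_smul_comm, ← mul_assoc, ← mul_assoc,
        eq_neg_of_add_eq_zero_left (ExteriorAlgebra.ι_add_mul_swap w v), pow_succ, mul_neg_one,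
        neg_smul, neg_mul, smul_neg]
  induction ha using Submodule.pow_induction_on_left' with
  | algebraMap r => simp [Algebra.commutes]
  | add x y i hx hy ihx ihy => simp only [add_mul, mul_add, ihx, ihy, smul_add]
  | mem_mul w hw i x hx ih =>
    obtain ⟨w, rfl⟩ := hw
    -- Using `key` on the right-hand side adds another `m'` to its exponent, so the two exponents
    -- differ by the even number `m' + m'`.
    rw [mul_assoc, ih, mul_smul_comm, ← mul_assoc, ← mul_assoc, key, smul_mul_assoc, smul_smul,
      ← pow_add, Nat.succ_mul, add_assoc, pow_add _ _ (m' + m'), ← two_mul, pow_mul (-1 : k) 2]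
    simp

theorem bihomogeneous_supercomm {N n m n' m' : ℕ} {f g : SuperPoly k N}
    (hf : f ∈ bihomogeneous k N n m) (hg : g ∈ bihomogeneous k N n' m') :
    f * g = (-1 : k) ^ (m * m') • (g * f) := by
  rw [bihomogeneous, Submodule.map₂_eq_span_image2] at hf hg
  induction hf using Submodule.span_induction with
  | zero => simp
  | add x y _ _ hx hy => simp only [add_mul, mul_add, hx, hy, smul_add]
  | smul c x _ hx => rw [smul_mul_assoc, hx, mul_smul_comm, smul_comm]
  | mem x hx =>
    obtain ⟨p, hp, a, ha, rfl⟩ := hx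
    induction hg using Submodule.span_induction with
    | zero => simp
    | add x y _ _ hx hy => simp only [add_mul, mul_add, hx, hy, smul_add]
    | smul c x _ hx => rw [mul_smul_comm, hx, smul_mul_assoc, smul_comm]
    | mem x hx =>
      obtain ⟨q, hq, b, hb, rfl⟩ := hx
      simp only [TensorProduct.mk_apply, Algebra.TensorProduct.tmul_mul_tmul]
      rw [exteriorPower_supercomm k ha hb, mul_comm p q, TensorProduct.tmul_smul]

theorem subst_mem_bihomogeneous {N M n m : ℕ} (φ : Fin N → Option (Fin M)) {f : SuperPoly k N}
    (hf : f ∈ bihomogeneous k N n m) : subst k φ f ∈ bihomogeneous k M n m := by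
  rw [bihomogeneous, Submodule.map₂_eq_span_image2] at hf
  induction hf using Submodule.span_induction with
  | zero => simp
  | add x y _ _ hx hy => rw [map_add]; exact add_mem hx hy
  | smul c x _ hx => rw [map_smul]; exact Submodule.smul_mem _ _ hx
  | mem x hx =>
    obtain ⟨p, hp, a, ha, rfl⟩ := hx
    refine Submodule.apply_mem_map₂ (TensorProduct.mk k _ _) (m := _) (n := _) ?_ ?_
    · have := MvPolynomial.IsHomogeneous.aeval (n := 1) hp
        (fun i => (φ i).elim (0 : MvPolynomial (Fin M) k) MvPolynomial.X) fun i => by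
          cases φ i with
          | none => exact MvPolynomial.isHomogeneous_zero _ _ _
          | some j => exact MvPolynomial.isHomogeneous_X _ _
      simpa using this
    · have h : ((⋀[k]^m (Fin N → k)).map (ExteriorAlgebra.map (Fintype.linearCombination k
          fun i => (φ i).elim 0 fun j => Pi.single j (1 : k))).toLinearMap) ≤
            ⋀[k]^m (Fin M → k) := by
        rw [ExteriorAlgebra.exteriorPower, ExteriorAlgebra.exteriorPower, Submodule.map_pow]
        refine pow_le_pow_left' ?_ m
        rintro _ ⟨_, ⟨v, rfl⟩, rfl⟩
        exact ⟨_, (ExteriorAlgebra.map_apply_ι _ v).symm⟩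
      exact h ⟨a, ha, rfl⟩

/-- The commutative algebra obtained from `k[x, θ]_N` by forgetting the part of degree `≥ 2`
in `θ`. -/
abbrev TruncPoly (N : ℕ) : Type u :=
  MvPolynomial (Fin N) k ⊗[k] TrivSqZeroExt k (Fin N → k)

/-- The even variables in `TruncPoly`. -/
def evenVar {N : ℕ} (i : Fin N) : TruncPoly k N := MvPolynomial.X i ⊗ₜ 1

/-- The odd variables in `TruncPoly`. -/
def oddVar {N : ℕ} (i : Fin N) : TruncPoly k N := 1 ⊗ₜ TrivSqZeroExt.inr (Pi.single i 1)

/-- The embedding of a trivial square zero extension into the exterior algebra. -/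
def toExterior (M : Type*) [AddCommGroup M] [Module k M] :
    TrivSqZeroExt k M →ₗ[k] ExteriorAlgebra k M :=
  (Algebra.linearMap k (ExteriorAlgebra k M)).coprod (ExteriorAlgebra.ι k)

@[simp]
theorem toExterior_inl {M : Type*} [AddCommGroup M] [Module k M] (r : k) :
    toExterior k M (TrivSqZeroExt.inl r) = algebraMap k _ r := by
  change (Algebra.linearMap k (ExteriorAlgebra k M)).coprod (ExteriorAlgebra.ι k) (r, 0) = _
  simp

@[simp]
theorem toExterior_inr {M : Type*} [AddCommGroup M] [Module k M] (v : M) :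
    toExterior k M (TrivSqZeroExt.inr v) = ExteriorAlgebra.ι k v := by
  change (Algebra.linearMap k (ExteriorAlgebra k M)).coprod (ExteriorAlgebra.ι k) (0, v) = _
  simp

@[simp]
theorem toExterior_one {M : Type*} [AddCommGroup M] [Module k M] :
    toExterior k M 1 = 1 := by
  rw [← TrivSqZeroExt.inl_one, toExterior_inl, map_one]

/-- The linear embedding of `TruncPoly` into `k[x, θ]_N`. -/
def toSuper (N : ℕ) : TruncPoly k N →ₗ[k] SuperPoly k N :=
  TensorProduct.map LinearMap.id (toExterior k _)

/-- The substitution of variables in `TruncPoly`. -/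
def truncSubst {N M : ℕ} (φ : Fin N → Option (Fin M)) : TruncPoly k N →ₐ[k] TruncPoly k M :=
  Algebra.TensorProduct.map
    (MvPolynomial.aeval fun i => (φ i).elim 0 MvPolynomial.X)
    (TrivSqZeroExt.map
      (Fintype.linearCombination k fun i => (φ i).elim 0 fun j => Pi.single j (1 : k)))

theorem prod_evenVar {N : ℕ} {ι : Type*} (s : Finset ι) (f : ι → Fin N) :
    ∏ i ∈ s, evenVar k (f i) = (∏ i ∈ s, MvPolynomial.X (f i)) ⊗ₜ 1 := by
  classical
  induction s using Finset.induction_on with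
  | empty => rfl
  | insert i s hi ih =>
    rw [Finset.prod_insert hi, Finset.prod_insert hi, ih, evenVar,
      Algebra.TensorProduct.tmul_mul_tmul, mul_one]

theorem truncSubst_evenVar {N M : ℕ} (φ : Fin N → Option (Fin M)) (i : Fin N) :
    truncSubst k φ (evenVar k i) = (φ i).elim 0 (evenVar k) := by
  cases h : φ i <;> simp [truncSubst, evenVar, h]

theorem truncSubst_oddVar {N M : ℕ} (φ : Fin N → Option (Fin M)) (i : Fin N) :
    truncSubst k φ (oddVar k i) = (φ i).elim 0 (oddVar k) := by
  cases h : φ i <;> simp [truncSubst, oddVar, h]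

theorem subst_toSuper {N M : ℕ} (φ : Fin N → Option (Fin M)) (f : TruncPoly k N) :
    subst k φ (toSuper k N f) = toSuper k M (truncSubst k φ f) := by
  induction f using TensorProduct.induction_on with
  | zero => simp
  | add x y hx hy => simp only [map_add, hx, hy]
  | tmul p a =>
    induction a using TrivSqZeroExt.ind with
    | _ r v => simp [subst, toSuper, truncSubst, TensorProduct.tmul_add]

/-- `toSuper` is not multiplicative in general: distinct odd variables multiply to zero in
`TruncPoly` but not in the exterior algebra. It is linear over the even polynomials. -/
theorem toSuper_left_mul {N : ℕ} (p : MvPolynomial (Fin N) k) (g : TruncPoly k N) :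
    toSuper k N (p ⊗ₜ 1 * g) = toSuper k N (p ⊗ₜ 1) * toSuper k N g := by
  induction g using TensorProduct.induction_on with
  | zero => simp
  | add x y hx hy => simp only [mul_add, map_add, hx, hy]
  | tmul q a => simp [toSuper, toExterior_one]

theorem toSuper_mul_left {N : ℕ} (p : MvPolynomial (Fin N) k) (g : TruncPoly k N) :
    toSuper k N (g * p ⊗ₜ 1) = toSuper k N g * toSuper k N (p ⊗ₜ 1) := by
  induction g using TensorProduct.induction_on with
  | zero => simp
  | add x y hx hy => simp only [add_mul, map_add, hx, hy]
  | tmul q a => simp [toSuper, toExterior_one]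

/-- The specialization `x_1 = 1`, `θ_1 = ε` on `TruncPoly`. -/
def truncZeta : TruncPoly k 1 →ₐ[k] DualNumber k :=
  Algebra.TensorProduct.productMap (MvPolynomial.aeval fun _ : Fin 1 => (1 : DualNumber k))
    (TrivSqZeroExt.map (LinearMap.proj (0 : Fin 1)))

/-- Since `ε² = 0`, the specialization is also an algebra morphism on `TruncPoly`, where it can be
applied directly to the weights of a colouring sum. -/
theorem zeta_toSuper (f : TruncPoly k 1) :
    Algebra.TensorProduct.productMap
      (MvPolynomial.aeval fun _ : Fin 1 => (1 : DualNumber k))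
      (ExteriorAlgebra.lift k
        ⟨(LinearMap.toSpanSingleton k (DualNumber k) DualNumber.eps) ∘ₗ
          LinearMap.proj (0 : Fin 1), fun v => by simp⟩) (toSuper k 1 f) = truncZeta k f := by
  induction f using TensorProduct.induction_on with
  | zero => simp
  | add x y hx hy => simp only [map_add, hx, hy]
  | tmul p a =>
    induction a using TrivSqZeroExt.ind with
    | _ r v =>
      simp [toSuper, truncZeta, TensorProduct.tmul_add, DualNumber.inr_eq_smul_eps,
        TrivSqZeroExt.algebraMap_eq_inl]

theorem truncZeta_evenVar (i : Fin 1) : truncZeta k (evenVar k i) = 1 := by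
  simp [truncZeta, evenVar]

theorem truncZeta_oddVar (i : Fin 1) : truncZeta k (oddVar k i) = DualNumber.eps := by
  rw [Subsingleton.elim i 0]
  simp only [truncZeta, oddVar, Algebra.TensorProduct.productMap_apply_tmul, map_one, one_mul,
    TrivSqZeroExt.map_inr, LinearMap.proj_apply, Pi.single_eq_same]
  rfl

theorem toSuper_mul_of_mem_range {N : ℕ} {f g : TruncPoly k N}
    (h : f ∈ (Algebra.TensorProduct.includeLeft : _ →ₐ[k] TruncPoly k N).range ∨
      g ∈ (Algebra.TensorProduct.includeLeft : _ →ₐ[k] TruncPoly k N).range) :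
    toSuper k N (f * g) = toSuper k N f * toSuper k N g := by
  rcases h with ⟨p, rfl⟩ | ⟨p, rfl⟩
  · exact toSuper_left_mul k p g
  · exact toSuper_mul_left k p f

theorem toSuper_noncommProd {N : ℕ} {ι : Type*} (s : Finset ι) (F : ι → TruncPoly k N)
    (hF : (s : Set ι).Pairwise fun i j =>
      F i ∈ (Algebra.TensorProduct.includeLeft : _ →ₐ[k] TruncPoly k N).range ∨
      F j ∈ (Algebra.TensorProduct.includeLeft : _ →ₐ[k] TruncPoly k N).range)
    (comm) : s.noncommProd (fun i => toSuper k N (F i)) comm = toSuper k N (∏ i ∈ s, F i) := by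
  classical
  induction s using Finset.induction_on with
  | empty => simp [Algebra.TensorProduct.one_def, toSuper]
  | insert i s hi ih =>
    rw [Finset.noncommProd_insert_of_notMem _ _ _ _ hi, Finset.prod_insert hi,
      ih (hF.mono (by simp)), ← toSuper_mul_of_mem_range]
    -- If the new factor is not purely even, the pairwise hypothesis makes all remaining factors
    -- even, hence their product too.
    by_cases h : F i ∈ (Algebra.TensorProduct.includeLeft : _ →ₐ[k] TruncPoly k N).range
    · exact Or.inl h
    · refine Or.inr (prod_mem fun j hj => ?_)
      exact (hF (by simp) (by simp [hj]) (ne_of_mem_of_not_mem hj hi).symm).resolve_left h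

/-- The chromatic symmetric polynomial in `N` supervariables of a two-coloured graph with at most
one white vertex. -/
def chromaticPoly (N : ℕ) {V : Type*} [Finite V] (Γ : SimpleGraph V) (W : Set V) : SuperPoly k N :=
  toSuper k N (coloringSum Γ W (evenVar k) (oddVar k))

variable {V : Type*} [Finite V] (Γ : SimpleGraph V)

/-- Without white vertices the second family of weights is never read; on the right it is filled
with `X` only to have some value. -/
theorem coloringSum_empty_eq {N : ℕ} {α : Type*} [Finite α] (f : α → Fin N) :
    coloringSum Γ ∅ (fun i => evenVar k (f i)) (fun i => oddVar k (f i)) =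
      coloringSum Γ ∅ (fun i => MvPolynomial.X (f i)) (fun i => MvPolynomial.X (f i)) ⊗ₜ 1 := by
  have := map_coloringSum (Algebra.TensorProduct.includeLeft : _ →ₐ[k] TruncPoly k N) Γ ∅
    (fun i => MvPolynomial.X (f i)) (fun i => MvPolynomial.X (f i))
  rw [Algebra.TensorProduct.includeLeft_apply] at this
  rw [this]
  classical
  have := Fintype.ofFinite V
  have := Fintype.ofFinite (Γ.Coloring α)
  simp [coloringSum_def, evenVar]

theorem coloringSum_mem_range {N : ℕ} {α : Type*} [Finite α] (f : α → Fin N) {W : Set V}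
    (hW : W.ncard = 0) : coloringSum Γ W (fun i => evenVar k (f i)) (fun i => oddVar k (f i)) ∈
      (Algebra.TensorProduct.includeLeft : _ →ₐ[k] TruncPoly k N).range := by
  obtain rfl := (Set.ncard_eq_zero).1 hW
  exact ⟨_, (coloringSum_empty_eq k Γ f).symm⟩

theorem chromaticPoly_singleton (N : ℕ) [Fintype V] [DecidableEq V]
    [Fintype (Γ.Coloring (Fin N))] (w : V) :
    chromaticPoly k N Γ {w} = ∑ κ : Γ.Coloring (Fin N),
      (∏ v ∈ Finset.univ.erase w, MvPolynomial.X (κ v)) ⊗ₜ[k]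
        ExteriorAlgebra.ι k (Pi.single (κ w) 1) := by
  classical
  rw [chromaticPoly, coloringSum_def, map_sum]
  refine Finset.sum_congr rfl fun κ _ => ?_
  refine (congrArg (toSuper k N) (a₂ := oddVar k (κ w) *
    (∏ v ∈ Finset.univ.erase w, MvPolynomial.X (κ v)) ⊗ₜ 1) ?_).trans ?_
  · rw [← Finset.mul_prod_erase _ _ (Finset.mem_univ w), if_pos (Set.mem_singleton w)]
    refine congrArg _ ((Finset.prod_congr rfl fun v hv => ?_).trans
      (prod_evenVar k _ _))
    exact if_neg (Finset.ne_of_mem_erase hv)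
  · rw [oddVar, Algebra.TensorProduct.tmul_mul_tmul]
    simp [toSuper]

theorem chromaticPoly_mem_bihomogeneous (N : ℕ) {W : Set V} (hW : W.ncard ≤ 1) :
    chromaticPoly k N Γ W ∈ bihomogeneous k N Wᶜ.ncard W.ncard := by
  classical
  have := Fintype.ofFinite V
  have := Fintype.ofFinite (Γ.Coloring (Fin N))
  rcases Nat.le_one_iff_eq_zero_or_eq_one.1 hW with h | h
  · obtain rfl := (Set.ncard_eq_zero).1 h
    have he := coloringSum_empty_eq k Γ (id : Fin N → Fin N)
    simp only [id_eq] at he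
    rw [chromaticPoly, he, toSuper, TensorProduct.map_tmul, toExterior_one]
    refine Submodule.apply_mem_map₂ (TensorProduct.mk k _ _) (n := 1) ?_ (by simp)
    rw [coloringSum_def]
    refine sum_mem fun κ _ => ?_
    have := MvPolynomial.IsHomogeneous.prod (Finset.univ : Finset V)
      (fun v => (MvPolynomial.X (κ v) : MvPolynomial (Fin N) k)) (fun _ => 1)
      (fun v _ => MvPolynomial.isHomogeneous_X _ _)
    simpa [Set.ncard_univ] using this
  · obtain ⟨w, rfl⟩ := Set.ncard_eq_one.1 h
    rw [chromaticPoly_singleton]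
    refine sum_mem fun κ _ => ?_
    refine Submodule.apply_mem_map₂ (TensorProduct.mk k _ _) ?_ ?_
    · have := MvPolynomial.IsHomogeneous.prod (Finset.univ.erase w)
        (fun v => (MvPolynomial.X (κ v) : MvPolynomial (Fin N) k)) (fun _ => 1)
        (fun v _ => MvPolynomial.isHomogeneous_X _ _)
      rw [Set.ncard_eq_toFinset_card']
      simpa [Finset.compl_singleton] using this
    · rw [Set.ncard_singleton, ExteriorAlgebra.exteriorPower, pow_one]
      exact ⟨_, rfl⟩

theorem subst_chromaticPoly {N M : ℕ} (φ : Fin N → Option (Fin M)) (W : Set V) :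
    subst k φ (chromaticPoly k N Γ W) = toSuper k M (coloringSum Γ W
      (fun i => (φ i).elim 0 (evenVar k)) (fun i => (φ i).elim 0 (oddVar k))) := by
  rw [chromaticPoly, subst_toSuper, map_coloringSum]
  simp only [truncSubst_evenVar, truncSubst_oddVar]

/-- Permuting the variables amounts to permuting the colours, which permutes the proper colourings.
-/
theorem permAct_chromaticPoly {N : ℕ} (σ : Equiv.Perm (Fin N)) (W : Set V) :
    permAct k σ (chromaticPoly k N Γ W) = chromaticPoly k N Γ W := by
  rw [permAct, subst_chromaticPoly]
  exact congrArg _ (coloringSum_embedding Γ W σ.toEmbedding (evenVar k) (oddVar k)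
    (fun b hb => (hb (σ.surjective b)).elim) fun b hb => (hb (σ.surjective b)).elim)

/-- Truncation gives the colours from `N` on weight zero, so only colourings with the first `N`
colours survive. -/
theorem trunc_chromaticPoly {N M : ℕ} (h : N ≤ M) (W : Set V) :
    trunc k M N (chromaticPoly k M Γ W) = chromaticPoly k N Γ W := by
  rw [trunc, subst_chromaticPoly, ← coloringSum_embedding Γ W (Fin.castLEEmb h), chromaticPoly]
  · simp
  all_goals
    intro b hb
    rw [dif_neg]
    · rfl
    · exact fun hlt => hb ⟨⟨b, hlt⟩, rfl⟩

theorem chromaticPoly_mem_symBi {W : Set V} (hW : W.ncard ≤ 1) :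
    (fun N => chromaticPoly k N Γ W) ∈ SymBi k Wᶜ.ncard W.ncard :=
  ⟨fun N => chromaticPoly_mem_bihomogeneous k Γ N hW, fun _ σ => permAct_chromaticPoly k Γ σ W,
    fun _ _ h => trunc_chromaticPoly k Γ h W⟩

theorem chromaticPoly_iso {V' : Type*} [Finite V'] {Γ : SimpleGraph V} {Γ' : SimpleGraph V'}
    {W : Set V} {W' : Set V'} (e : Γ ≃g Γ') (he : ∀ v, e v ∈ W' ↔ v ∈ W) (N : ℕ) :
    chromaticPoly k N Γ W = chromaticPoly k N Γ' W' :=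
  congrArg _ (coloringSum_iso e he _ _)

end SuperPolynomials

/-! ### The morphism and its compatibility with degree, parity, counit and supercharacter -/

section ChromaticMorphism

variable (k : Type u) [Field k]

theorem symBi_le_symFun (n m : ℕ) : SymBi k n m ≤ Subalgebra.toSubmodule (SymFun k) :=
  le_iSup (fun p : ℕ × ℕ => SymBi k p.1 p.2) (n, m)

/-- The chromatic symmetric function in superspace of a connected two-coloured graph. -/
def chromaticGen (G : ConnTriple) : SymFun k :=
  ⟨fun N => chromaticPoly k N G.graph G.white,
    symBi_le_symFun k _ _ (chromaticPoly_mem_symBi k G.graph G.white_le)⟩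

theorem chromaticPoly_mk' {V : Type*} [Finite V] (Γ : SimpleGraph V) (W : Set V)
    (hΓ : Γ.Connected) (hW : W.ncard ≤ 1) (N : ℕ) :
    chromaticPoly k N (ConnTriple.mk' Γ W hΓ hW).graph (ConnTriple.mk' Γ W hΓ hW).white =
      chromaticPoly k N Γ W :=
  chromaticPoly_iso k (SimpleGraph.Iso.comap (Finite.equivFin V).symm Γ) (fun _ => Iff.rfl) N

/-- The polynomial of a symmetric function in `N` supervariables. -/
def SymFun.eval (N : ℕ) : SymFun k →ₐ[k] SuperPoly k N :=
  (Pi.evalAlgHom k (fun N => SuperPoly k N) N).comp (SymFun k).val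

/-- The morphism `Ψ_ch : 𝓖 → 𝚲`. -/
def chromaticHom : Chrom k →ₐ[k] SymFun k :=
  Chrom.lift (chromaticGen k)
    (fun _ _ ⟨e, he⟩ => Subtype.ext (funext fun N => chromaticPoly_iso k e he N))
    (fun G H => Subtype.ext (funext fun N =>
      bihomogeneous_supercomm k (chromaticPoly_mem_bihomogeneous k G.graph N G.white_le)
        (chromaticPoly_mem_bihomogeneous k H.graph N H.white_le)))

theorem chromaticHom_gen (G : ConnTriple) (N : ℕ) :
    (chromaticHom k (Chrom.gen k G)).1 N = chromaticPoly k N G.graph G.white := by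
  rw [chromaticHom, Chrom.lift_gen]
  rfl

/-- This bigraded statement yields both the degree and the parity condition, because the
corresponding parts of `𝓖` are spanned by words. -/
theorem chromaticHom_word_mem (l : List ConnTriple) : (chromaticHom k (Chrom.word k l)).1 ∈
    SymBi k (l.map ConnTriple.numBlack).sum (l.map ConnTriple.numWhite).sum := by
  induction l with
  | nil => simpa [Chrom.word] using one_mem_symBi k
  | cons G l ih =>
    have hw : Chrom.word k (G :: l) = Chrom.gen k G * Chrom.word k l := by simp [Chrom.word]
    rw [hw, map_mul, List.map_cons, List.map_cons, List.sum_cons, List.sum_cons]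
    refine mul_mem_symBi k ?_ ih
    rw [chromaticHom, Chrom.lift_gen]
    exact chromaticPoly_mem_symBi k G.graph G.white_le

theorem chromaticHom_degree (d : ℕ) (a : Chrom k) (ha : a ∈ Chrom.degreePart k d) :
    chromaticHom k a ∈ SymFun.degreePart k d := by
  have : Chrom.degreePart k d ≤
      (SymFun.degreePart k d).comap (chromaticHom k).toLinearMap := by
    refine iSup_le fun p => Submodule.span_le.2 ?_
    rintro _ ⟨l, h1, h2, rfl⟩
    refine Submodule.mem_iSup_of_mem p ?_
    rw [← h1, ← h2]
    exact chromaticHom_word_mem k l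
  exact this ha

theorem chromaticHom_parity (p : ZMod 2) (a : Chrom k) (ha : a ∈ Chrom.parityPart k p) :
    chromaticHom k a ∈ SymFun.parityPart k p := by
  have : Chrom.parityPart k p ≤
      (SymFun.parityPart k p).comap (chromaticHom k).toLinearMap := by
    refine Submodule.span_le.2 ?_
    rintro _ ⟨l, h, rfl⟩
    exact Submodule.mem_iSup_of_mem
      (⟨(_, _), h⟩ : {q : ℕ × ℕ // (q.2 : ZMod 2) = p}) (chromaticHom_word_mem k l)
  exact this ha

-- Extends the colouring formula from generators to disconnected graphs, as needed for the
-- restrictions in the comultiplication. At most one component has a white vertex, so `toSuper`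
-- respects the product over components.
open Classical in
theorem chromaticHom_cls {V : Type*} [Finite V] (Γ : SimpleGraph V) (W : Set V)
    (hW : W.ncard ≤ 1) (N : ℕ) :
    (chromaticHom k (Chrom.cls k Γ W hW)).1 N = chromaticPoly k N Γ W := by
  let _ := Fintype.ofFinite Γ.ConnectedComponent
  have h1 : ∀ c, (SymFun.eval k N).comp (chromaticHom k)
      (Chrom.gen k (Chrom.component Γ W hW c)) =
      toSuper k N (coloringSum c.toSimpleGraph ((Subtype.val : c → V) ⁻¹' W)
        (evenVar k) (oddVar k)) := fun c =>
    (chromaticHom_gen k _ N).trans (chromaticPoly_mk' k _ _ _ _ N)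
  change (SymFun.eval k N).comp (chromaticHom k) (Chrom.cls k Γ W hW) = _
  rw [Chrom.cls, Finset.map_noncommProd]
  simp only [h1]
  rw [toSuper_noncommProd, chromaticPoly, coloringSum_components]
  intro c _ d _ hcd
  have h3 := Chrom.sum_component_numWhite Γ W hW
  -- Two distinct components cannot both contain a white vertex.
  have h4 : (Chrom.component Γ W hW c).numWhite + (Chrom.component Γ W hW d).numWhite ≤
      W.ncard := by
    rw [← h3, ← Finset.sum_pair hcd (f := fun c => (Chrom.component Γ W hW c).numWhite)]
    exact Finset.sum_le_sum_of_subset (Finset.subset_univ _)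
  rw [Chrom.component, ConnTriple.mk'_numWhite, Chrom.component, ConnTriple.mk'_numWhite] at h4
  by_cases hc : ((Subtype.val : c → V) ⁻¹' W).ncard = 0
  · exact Or.inl (coloringSum_mem_range k _ id hc)
  · exact Or.inr (coloringSum_mem_range k _ id (by omega))

/-- A connected graph is nonempty and so has no colouring with zero colours; thus both sides vanish
on generators. -/
theorem chromaticHom_counit (a : Chrom k) :
    (chromaticHom k a).1 0 = algebraMap k (SuperPoly k 0) (Chrom.counit k a) := by
  have h : (SymFun.eval k 0).comp (chromaticHom k) =
      (Algebra.ofId k (SuperPoly k 0)).comp (Chrom.counit k) := by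
    refine Chrom.hom_ext fun G => ?_
    have h1 : Chrom.counit k (Chrom.gen k G) = 0 := by rw [Chrom.counit, Chrom.lift_gen]
    rw [AlgHom.comp_apply (Algebra.ofId _ _), h1, map_zero]
    refine (chromaticHom_gen k G 0).trans ?_
    classical
    have := Fintype.ofFinite (G.graph.Coloring (Fin 0))
    have : IsEmpty (G.graph.Coloring (Fin 0)) := ⟨fun κ => (κ G.connected.nonempty.some).elim0⟩
    rw [chromaticPoly, coloringSum_def, Finset.univ_eq_empty, Finset.sum_empty, map_zero]
  exact DFunLike.congr_fun h a

/-- With a single colour only the constant colouring is available, and it is proper exactly when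
there are no edges. -/
theorem coloringSum_of_subsingleton {R : Type*} [CommRing R] {V : Type*} [Finite V]
    {α : Type*} [Finite α] [Subsingleton α] [Nonempty α] (Γ : SimpleGraph V) (W : Set V) (t : R)
    [Decidable (Γ.edgeSet = ∅)] :
    coloringSum Γ W (fun _ : α => 1) (fun _ => t) = if Γ.edgeSet = ∅ then t ^ W.ncard else 0 := by
  classical
  have := Fintype.ofFinite V
  have := Fintype.ofFinite (Γ.Coloring α)
  have : Subsingleton (Γ.Coloring α) := ⟨fun κ κ' => by ext v; exact Subsingleton.elim _ _⟩
  rw [coloringSum_def]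
  split_ifs with h
  · have h' : ∀ {v w : V}, ¬ Γ.Adj v w := fun {v w} hvw =>
      Set.notMem_empty _ (h ▸ (SimpleGraph.mem_edgeSet Γ).2 hvw)
    let κ : Γ.Coloring α := SimpleGraph.Coloring.mk (fun _ => Classical.arbitrary α)
      fun hvw => (h' hvw).elim
    rw [Fintype.sum_subsingleton _ κ, Finset.prod_ite, Finset.prod_const, Finset.prod_const_one,
      mul_one, Set.ncard_eq_toFinset_card']
    congr 2
    ext v
    simp
  · have : IsEmpty (Γ.Coloring α) := ⟨fun κ => h (by
      rw [SimpleGraph.edgeSet_eq_empty, SimpleGraph.eq_bot_iff_forall_not_adj]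
      exact fun v w hvw => κ.valid hvw (Subsingleton.elim _ _))⟩
    rw [Finset.univ_eq_empty, Finset.sum_empty]

theorem chromaticHom_zeta (a : Chrom k) : zetaS k (chromaticHom k a) = Chrom.zetaCh k a := by
  have h : (zetaS k).comp (chromaticHom k) = Chrom.zetaCh k := by
    refine Chrom.hom_ext fun G => ?_
    classical
    have h1 : zetaS k (chromaticHom k (Chrom.gen k G)) =
        truncZeta k (coloringSum G.graph G.white (evenVar k) (oddVar k)) := by
      rw [← zeta_toSuper]
      change Algebra.TensorProduct.productMap _ _ ((chromaticHom k (Chrom.gen k G)).1 1) = _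
      rw [chromaticHom_gen]
      rfl
    rw [AlgHom.comp_apply, h1, map_coloringSum, Chrom.zetaCh, Chrom.lift_gen]
    simp only [truncZeta_evenVar, truncZeta_oddVar]
    rw [coloringSum_of_subsingleton, Chrom.zetaGen]
    have := G.white_le
    rw [ConnTriple.numWhite]
    -- The power of `ε` in the edgeless case is `1` or `ε`, matching the cases of `Chrom.zetaGen`.
    interval_cases G.white.ncard <;> simp
  exact DFunLike.congr_fun h a

end ChromaticMorphism

/-! ### Compatibility with the comultiplication -/

section Comultiplication

variable (k : Type u) [Field k]

/-- `Ψ_ch` evaluated at supervariables that are obtained by the substitution `φ`. -/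
def chromaticSubst {N M : ℕ} (φ : Fin N → Option (Fin M)) : Chrom k →ₐ[k] SuperPoly k M :=
  (subst k φ).comp ((SymFun.eval k N).comp (chromaticHom k))

variable {k} in
-- Passes by bilinearity from words to the parity parts and rewrites the sign with exponent in `ZMod
-- 2`, the form `GradedTensorProduct.lift` requires.
theorem supercomm_of_word {A : Type*} [Ring A] [Algebra k A] (f g : Chrom k →ₐ[k] A)
    (h : ∀ l l' : List ConnTriple, f (Chrom.word k l) * g (Chrom.word k l') =
      (-1 : k) ^ ((l.map ConnTriple.numWhite).sum * (l'.map ConnTriple.numWhite).sum) •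
        (g (Chrom.word k l') * f (Chrom.word k l)))
    {i j : ZMod 2} {a b : Chrom k} (ha : a ∈ Chrom.parityPart k i)
    (hb : b ∈ Chrom.parityPart k j) : f a * g b = (-1 : ℤˣ) ^ (j * i) • (g b * f a) := by
  induction ha using Submodule.span_induction with
  | zero => simp
  | add x y _ _ hx hy => simp only [map_add, add_mul, mul_add, hx, hy, smul_add]
  | smul c x _ hx => rw [map_smul, smul_mul_assoc, hx, mul_smul_comm, smul_comm]
  | mem x hx =>
    obtain ⟨l, rfl, rfl⟩ := hx
    induction hb using Submodule.span_induction with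
    | zero => simp
    | add x y _ _ hx hy => simp only [map_add, add_mul, mul_add, hx, hy, smul_add]
    | smul c x _ hx => rw [map_smul, mul_smul_comm, hx, smul_mul_assoc, smul_comm]
    | mem x hx =>
      obtain ⟨l', rfl, rfl⟩ := hx
      rw [h, Chrom.neg_one_pow_smul, mul_comm (Nat.cast _ : ZMod 2)]

theorem chromaticSubst_word_mem {N M : ℕ} (φ : Fin N → Option (Fin M)) (l : List ConnTriple) :
    chromaticSubst k φ (Chrom.word k l) ∈ bihomogeneous k M (l.map ConnTriple.numBlack).sum
      (l.map ConnTriple.numWhite).sum :=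
  subst_mem_bihomogeneous k φ ((chromaticHom_word_mem k l).1 N)

/-- The morphism `a ⊗ b ↦ Ψ_ch(a)(x; θ) Ψ_ch(b)(y; φ)`. -/
def chromaticTensor (N M : ℕ) :
    Chrom.parityPart k ᵍ⊗[k] Chrom.parityPart k →ₐ[k] SuperPoly k (N + M) :=
  GradedTensorProduct.lift (Chrom.parityPart k) (Chrom.parityPart k)
    (chromaticSubst k fun i : Fin N => some (Fin.castAdd M i))
    (chromaticSubst k fun j : Fin M => some (Fin.natAdd N j))
    (fun _ _ a b => supercomm_of_word _ _ (fun l l' => bihomogeneous_supercomm k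
      (chromaticSubst_word_mem k _ l) (chromaticSubst_word_mem k _ l')) a.2 b.2)

/-- `evalTensor` is merely linear, but on the image of the morphism it agrees with an algebra
morphism from the super tensor product. The comultiplication identity can therefore be checked on
connected graphs. -/
theorem evalTensor_chromaticHom (N M : ℕ) (t : Chrom.parityPart k ᵍ⊗[k] Chrom.parityPart k) :
    evalTensor k N M (TensorProduct.map (chromaticHom k).toLinearMap (chromaticHom k).toLinearMap
      ((GradedTensorProduct.of k (Chrom.parityPart k) (Chrom.parityPart k)).symm t)) =
      chromaticTensor k N M t := by
  obtain ⟨s, rfl⟩ := (GradedTensorProduct.of k (Chrom.parityPart k) (Chrom.parityPart k)).surjective t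
  rw [GradedTensorProduct.of_symm_of]
  induction s using TensorProduct.induction_on with
  | zero => simp
  | add x y hx hy => simp only [map_add, hx, hy]
  | tmul a b => rfl

variable {k} in
theorem toSuper_coloringSum_mul {N : ℕ} {V V' : Type*} [Finite V] [Finite V']
    {α β : Type*} [Finite α] [Finite β] (Γ : SimpleGraph V) (Γ' : SimpleGraph V')
    (W : Set V) (W' : Set V') (h : W.ncard = 0 ∨ W'.ncard = 0) (f : α → Fin N) (g : β → Fin N) :
    toSuper k N (coloringSum Γ W (fun i => evenVar k (f i)) (fun i => oddVar k (f i)) *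
      coloringSum Γ' W' (fun i => evenVar k (g i)) (fun i => oddVar k (g i))) =
    toSuper k N (coloringSum Γ W (fun i => evenVar k (f i)) (fun i => oddVar k (f i))) *
      toSuper k N (coloringSum Γ' W' (fun i => evenVar k (g i)) (fun i => oddVar k (g i))) :=
  toSuper_mul_of_mem_range k (h.imp (coloringSum_mem_range k Γ f)
    (coloringSum_mem_range k Γ' g))

variable {k} in
theorem chromaticSubst_restrict {N M : ℕ} (φ : Fin N → Fin M) (G : ConnTriple)
    (S : Set (Fin G.n)) :
    chromaticSubst k (fun i => some (φ i)) (Chrom.restrict k G S) =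
      toSuper k M (coloringSum (G.graph.induce S) ((Subtype.val : S → Fin G.n) ⁻¹' G.white)
        (fun i => evenVar k (φ i)) (fun i => oddVar k (φ i))) := by
  change subst k _ ((chromaticHom k (Chrom.restrict k G S)).1 N) = _
  rw [Chrom.restrict, chromaticHom_cls, subst_chromaticPoly]
  rfl

theorem ncard_inter_mul_ncard_inter_compl (G : ConnTriple) (S : Set (Fin G.n)) :
    (G.white ∩ S).ncard = 0 ∨ (G.white ∩ Sᶜ).ncard = 0 := by
  have h := Set.ncard_inter_add_ncard_sdiff_eq_ncard G.white S
  have := G.white_le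
  rw [Set.sdiff_eq] at h
  omega

/-- The `N + M` colours are regarded as `Fin N ⊕ Fin M`. The white vertex, if any, lies in only one
of `S` and `Sᶜ`, so one of the two factors is even and `toSuper` splits the product. -/
theorem chromaticPoly_add (N M : ℕ) (G : ConnTriple) [Fintype (Set (Fin G.n))] :
    chromaticPoly k (N + M) G.graph G.white = ∑ S : Set (Fin G.n),
      chromaticSubst k (fun i : Fin N => some (Fin.castAdd M i)) (Chrom.restrict k G S) *
      chromaticSubst k (fun j : Fin M => some (Fin.natAdd N j)) (Chrom.restrict k G Sᶜ) := by
  rw [chromaticPoly, ← coloringSum_embedding G.graph G.white finSumFinEquiv.toEmbedding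
    (evenVar k) (oddVar k) (fun b hb => (hb (finSumFinEquiv.surjective b)).elim)
    fun b hb => (hb (finSumFinEquiv.surjective b)).elim, coloringSum_sum, map_sum]
  refine Finset.sum_congr rfl fun S _ => ?_
  rw [chromaticSubst_restrict, chromaticSubst_restrict]
  refine toSuper_coloringSum_mul _ _ _ _ ?_ _ _
  have key : ∀ T : Set (Fin G.n), ((Subtype.val : T → Fin G.n) ⁻¹' G.white).ncard =
      (G.white ∩ T).ncard := fun T => by
    rw [← Set.ncard_image_of_injective _ Subtype.val_injective, Subtype.image_preimage_coe,
      Set.inter_comm]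
  rw [key, key]
  exact ncard_inter_mul_ncard_inter_compl G S

theorem chromaticTensor_comulGen [CharZero k] (N M : ℕ) (G : ConnTriple) :
    chromaticTensor k N M (Chrom.comulGen k G) = chromaticPoly k (N + M) G.graph G.white := by
  classical
  -- All signs in the comultiplication of a connected graph are trivial. The two halves of the
  -- symmetrized sum then agree after replacing `S` by its complement (`h3`), cancelling the factor
  -- one half.
  have h1 : ∀ S : Set (Fin G.n), (G.white ∩ S).ncard * (G.white ∩ Sᶜ).ncard = 0 := fun S =>
    Nat.mul_eq_zero.2 (ncard_inter_mul_ncard_inter_compl G S)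
  simp only [Chrom.comulGen, h1, pow_zero, one_smul, Finset.sum_add_distrib, map_smul, map_add,
    map_sum]
  have h2 : ∀ S T : Set (Fin G.n), chromaticTensor k N M
      (Chrom.restrict k G S ᵍ⊗ₜ[k] Chrom.restrict k G T) =
      chromaticSubst k (fun i : Fin N => some (Fin.castAdd M i)) (Chrom.restrict k G S) *
      chromaticSubst k (fun j : Fin M => some (Fin.natAdd N j)) (Chrom.restrict k G T) :=
    fun S T => rfl
  have h3 : ∑ S : Set (Fin G.n), chromaticTensor k N M
      (Chrom.restrict k G Sᶜ ᵍ⊗ₜ[k] Chrom.restrict k G S) =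
      ∑ S : Set (Fin G.n), chromaticTensor k N M
      (Chrom.restrict k G S ᵍ⊗ₜ[k] Chrom.restrict k G Sᶜ) :=
    Fintype.sum_equiv (compl_involutive.toPerm) _ _ fun S => by simp
  rw [h3, ← two_smul k, smul_smul, inv_mul_cancel₀ two_ne_zero, one_smul, chromaticPoly_add]
  exact Finset.sum_congr (by congr!) fun S _ => h2 _ _

theorem chromaticHom_comul [CharZero k] (a : Chrom k) : SymFun.IsComul k (chromaticHom k a)
    (TensorProduct.map (chromaticHom k).toLinearMap (chromaticHom k).toLinearMap
      ((GradedTensorProduct.of k (Chrom.parityPart k) (Chrom.parityPart k)).symm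
        (Chrom.comul k a))) := by
  intro N M
  rw [evalTensor_chromaticHom]
  have h : (chromaticTensor k N M).comp (Chrom.comul k) =
      (SymFun.eval k (N + M)).comp (chromaticHom k) := by
    refine Chrom.hom_ext fun G => ?_
    rw [AlgHom.comp_apply, Chrom.comul, Chrom.lift_gen, chromaticTensor_comulGen]
    exact (chromaticHom_gen k G (N + M)).symm
  exact DFunLike.congr_fun h a

theorem isChromaticMorphism_chromaticHom [CharZero k] :
    IsChromaticMorphism k (chromaticHom k) where
  map_degree := chromaticHom_degree k
  map_parity := chromaticHom_parity k
  map_comul := chromaticHom_comul k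
  map_counit := chromaticHom_counit k
  map_zeta := chromaticHom_zeta k

end Comultiplication

/-! ### Uniqueness: recovering a symmetric function from its one-variable specializations -/

section Uniqueness

variable (k : Type u) [Field k]

/-- The specialization `x_1 = 1`, `θ_1 = ε` on `k[x, θ]_1`. -/
def zetaOne : SuperPoly k 1 →ₐ[k] DualNumber k :=
  Algebra.TensorProduct.productMap
    (MvPolynomial.aeval fun _ : Fin 1 => (1 : DualNumber k))
    (ExteriorAlgebra.lift k
      ⟨(LinearMap.toSpanSingleton k (DualNumber k) DualNumber.eps) ∘ₗ LinearMap.proj (0 : Fin 1),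
        fun v => by simp⟩)

/-- The element of `k[x, θ]_1` of degree `d` that specializes to a given element of `k[ε]`. -/
def zetaSection (d : ℕ) : DualNumber k →ₗ[k] SuperPoly k 1 :=
  LinearMap.coprod
    (LinearMap.toSpanSingleton k (SuperPoly k 1) ((MvPolynomial.X 0 ^ d) ⊗ₜ 1))
    (LinearMap.toSpanSingleton k (SuperPoly k 1)
      ((MvPolynomial.X 0 ^ (d - 1)) ⊗ₜ ExteriorAlgebra.ι k (Pi.single 0 1)))

theorem zetaSection_apply (d : ℕ) (z : DualNumber k) : zetaSection k d z =
    z.fst • ((MvPolynomial.X 0 ^ d : MvPolynomial (Fin 1) k) ⊗ₜ 1) +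
      z.snd • ((MvPolynomial.X 0 ^ (d - 1) : MvPolynomial (Fin 1) k) ⊗ₜ
        ExteriorAlgebra.ι k (Pi.single 0 1)) :=
  rfl

theorem exists_eq_smul_X_pow {n : ℕ} {p : MvPolynomial (Fin 1) k} (hp : p.IsHomogeneous n) :
    ∃ c : k, p = c • MvPolynomial.X 0 ^ n := by
  refine ⟨p.coeff (Finsupp.single 0 n), ?_⟩
  ext s
  rw [MvPolynomial.coeff_smul, MvPolynomial.coeff_X_pow]
  split_ifs with h
  · rw [← h]; simp
  · rw [hp.coeff_eq_zero, smul_zero]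
    intro hs
    refine h ?_
    refine Finsupp.ext fun i => ?_
    rw [Subsingleton.elim i 0, ← hs, Finsupp.degree_eq_sum]
    simp

/-- Fixing the total degree makes `ζ_S` injective in one supervariable: only `x^d` and `x^(d-1) θ`
are available, and their images `1` and `ε` are independent. -/
theorem zetaSection_zetaOne {d : ℕ} {f : SuperPoly k 1}
    (hf : f ∈ ⨆ p : {p : ℕ × ℕ // p.1 + p.2 = d}, bihomogeneous k 1 p.1.1 p.1.2) :
    zetaSection k d (zetaOne k f) = f := by
  have key : (⨆ p : {p : ℕ × ℕ // p.1 + p.2 = d}, bihomogeneous k 1 p.1.1 p.1.2) ≤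
      LinearMap.eqLocus (zetaSection k d ∘ₗ (zetaOne k).toLinearMap) LinearMap.id := by
    refine iSup_le ?_
    rintro ⟨⟨n, m⟩, h⟩
    refine Submodule.map₂_le.2 fun p hp a ha => ?_
    obtain ⟨c, rfl⟩ := exists_eq_smul_X_pow k hp
    change zetaSection k d (zetaOne k ((c • MvPolynomial.X 0 ^ n) ⊗ₜ a)) =
      (c • MvPolynomial.X 0 ^ n) ⊗ₜ a
    rcases m with _ | _ | m
    · rw [ExteriorAlgebra.exteriorPower, pow_zero, Submodule.mem_one] at ha
      obtain ⟨r, rfl⟩ := ha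
      obtain rfl : n = d := by simpa using h
      simp [zetaOne, zetaSection_apply, TensorProduct.smul_tmul', Algebra.algebraMap_eq_smul_one]
    · replace ha : a ∈ LinearMap.range (ExteriorAlgebra.ι k (M := Fin 1 → k)) ^ 1 := ha
      rw [pow_one] at ha
      obtain ⟨v, rfl⟩ := ha
      -- A `θ` of degree one forces `d` to be positive, so the truncated `d - 1` in `zetaSection` is
      -- the true exponent `n`.
      obtain rfl : n + 1 = d := by simpa using h
      have hv : v = v 0 • Pi.single 0 1 := by
        ext i
        rw [Subsingleton.elim i 0]
        simp
      rw [hv]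
      simp [zetaOne, zetaSection_apply, TensorProduct.smul_tmul']
    -- With a single odd variable, everything of degree at least two in `θ` vanishes.
    · have h0 : a ∈ (⊥ : Submodule k (ExteriorAlgebra k (Fin 1 → k))) := by
        have hsq : LinearMap.range (ExteriorAlgebra.ι k (M := Fin 1 → k)) ^ 2 = ⊥ := by
          rw [eq_bot_iff, pow_two, Submodule.mul_le]
          rintro _ ⟨v, rfl⟩ _ ⟨w, rfl⟩
          have hw : ∀ v : Fin 1 → k, v = v 0 • Pi.single 0 1 := fun v => by
            ext i
            rw [Subsingleton.elim i 0]
            simp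
          rw [hw v, hw w]
          simp
        rw [ExteriorAlgebra.exteriorPower, pow_add _ m 2, hsq] at ha
        simpa using ha
      rw [(Submodule.mem_bot k).1 h0]
      simp
  exact key hf

theorem eval_mem_of_mem_degreePart {d N : ℕ} {f : SymFun k} (hf : f ∈ SymFun.degreePart k d) :
    f.1 N ∈ ⨆ p : {p : ℕ × ℕ // p.1 + p.2 = d}, bihomogeneous k N p.1.1 p.1.2 := by
  have key : (⨆ p : {p : ℕ × ℕ // p.1 + p.2 = d}, SymBi k p.1.1 p.1.2) ≤
      (⨆ p : {p : ℕ × ℕ // p.1 + p.2 = d}, bihomogeneous k N p.1.1 p.1.2).comap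
        (LinearMap.proj N : (∀ N, SuperPoly k N) →ₗ[k] SuperPoly k N) :=
    iSup_le fun p g hg => Submodule.mem_iSup_of_mem p (hg.1 N)
  exact key hf

variable {k}

theorem IsChromaticMorphism.eval_one_eq {Ψ Ψ' : Chrom k →ₐ[k] SymFun k}
    (h : IsChromaticMorphism k Ψ) (h' : IsChromaticMorphism k Ψ') (a : Chrom k) :
    (Ψ a).1 1 = (Ψ' a).1 1 := by
  have key : (SymFun.eval k 1).comp Ψ = (SymFun.eval k 1).comp Ψ' := by
    refine Chrom.hom_ext fun G => ?_
    change (Ψ (Chrom.gen k G)).1 1 = (Ψ' (Chrom.gen k G)).1 1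
    have hG : Chrom.gen k G ∈ Chrom.degreePart k (G.numBlack + G.numWhite) := by
      refine Submodule.mem_iSup_of_mem ⟨(G.numBlack, G.numWhite), rfl⟩ ?_
      exact Submodule.subset_span ⟨[G], by simp, by simp, by simp [Chrom.word]⟩
    have hz : zetaOne k ((Ψ (Chrom.gen k G)).1 1) = zetaOne k ((Ψ' (Chrom.gen k G)).1 1) :=
      (h.map_zeta _).trans (h'.map_zeta _).symm
    rw [← zetaSection_zetaOne k (eval_mem_of_mem_degreePart k (h.map_degree _ _ hG)), hz,
      zetaSection_zetaOne k (eval_mem_of_mem_degreePart k (h'.map_degree _ _ hG))]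
  exact DFunLike.congr_fun key a

theorem evalTensor_map_congr {Ψ Ψ' : Chrom k →ₐ[k] SymFun k} {N M : ℕ}
    (hN : ∀ a, (Ψ a).1 N = (Ψ' a).1 N) (hM : ∀ a, (Ψ a).1 M = (Ψ' a).1 M)
    (t : Chrom k ⊗[k] Chrom k) :
    evalTensor k N M (TensorProduct.map Ψ.toLinearMap Ψ.toLinearMap t) =
      evalTensor k N M (TensorProduct.map Ψ'.toLinearMap Ψ'.toLinearMap t) := by
  induction t using TensorProduct.induction_on with
  | zero => simp
  | add x y hx hy => simp only [map_add, hx, hy]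
  | tmul a b =>
    change subst k _ ((Ψ a).1 N) * subst k _ ((Ψ b).1 M) =
      subst k _ ((Ψ' a).1 N) * subst k _ ((Ψ' b).1 M)
    rw [hN, hM]

theorem IsChromaticMorphism.unique {Ψ Ψ' : Chrom k →ₐ[k] SymFun k}
    (h : IsChromaticMorphism k Ψ) (h' : IsChromaticMorphism k Ψ') : Ψ = Ψ' := by
  have key : ∀ (N : ℕ) (a : Chrom k), (Ψ a).1 N = (Ψ' a).1 N := by
    intro N
    induction N with
    | zero => exact fun a => (h.map_counit a).trans (h'.map_counit a).symm
    | succ N ih =>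
      intro a
      -- Splitting off the last supervariable: both sides become the same tensor evaluated in `N`
      -- and in `1` supervariables, where the morphisms already agree.
      rw [← h.map_comul a N 1, ← h'.map_comul a N 1]
      exact evalTensor_map_congr ih (h.eval_one_eq h') _
  exact AlgHom.ext fun a => Subtype.ext (funext fun N => key N a)

end Uniqueness

/-! ### The complete graph with one white vertex -/

section CompleteGraph

variable (k : Type u) [Field k]

theorem elemTilde_eq_zero {n N : ℕ} (h : N < n + 1) : elemTilde k n N = 0 := by
  rw [elemTilde, monomialSym, if_neg]
  simp [SuperPartition.zeroOnes]
  omega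

/-- Each injective map `ι → α` extends to the same number of permutations of `α`. -/
theorem sum_perm_comp_embedding {ι α M : Type*} [Fintype ι] [Fintype α]
    [DecidableEq ι] [DecidableEq α] [AddCommMonoid M] (e : ι ↪ α) (F : (ι ↪ α) → M) :
    ∑ σ : Equiv.Perm α, F (e.trans σ.toEmbedding) =
      (Fintype.card α - Fintype.card ι).factorial • ∑ f : ι ↪ α, F f := by
  classical
  let fib (f : ι ↪ α) := Finset.univ.filter fun σ : Equiv.Perm α => e.trans σ.toEmbedding = f
  have hfib : ∀ f, (fib f).card = (fib e).card := by
    intro f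
    -- Left translation by such a `τ` carries the fibre over `e` to the fibre over `f`, so all
    -- fibres have the same size.
    obtain ⟨τ, hτ⟩ : ∃ τ : Equiv.Perm α, ∀ i, τ (e i) = f i := by
      let g := (Equiv.ofInjective e e.injective).symm.trans (Equiv.ofInjective f f.injective)
      refine ⟨Equiv.extendSubtype (p := (· ∈ Set.range e)) (q := (· ∈ Set.range f)) g,
        fun i => ?_⟩
      rw [Equiv.extendSubtype_apply_of_mem (p := (· ∈ Set.range e)) (q := (· ∈ Set.range f)) g
        (e i) ⟨i, rfl⟩]
      have : (Equiv.ofInjective e e.injective).symm ⟨e i, i, rfl⟩ = i :=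
        Equiv.ofInjective_symm_apply e.injective i
      simp [g, this]
    have hτ' : ∀ i, τ.symm (f i) = e i := fun i => by rw [← hτ, τ.symm_apply_apply]
    refine Finset.card_bij' (fun σ _ => τ⁻¹ * σ) (fun σ _ => τ * σ) ?_ ?_ (by simp) (by simp)
    · intro σ hσ
      simp only [fib, Finset.mem_filter, Finset.mem_univ, true_and] at hσ ⊢
      ext i
      have : σ (e i) = f i := DFunLike.congr_fun hσ i
      simp [this, hτ']
    · intro σ hσ
      simp only [fib, Finset.mem_filter, Finset.mem_univ, true_and] at hσ ⊢
      ext i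
      have : σ (e i) = e i := DFunLike.congr_fun hσ i
      simp [this, hτ]
  -- Count all permutations by fibres and divide by the number of embeddings, a descending
  -- factorial.
  have hcard : (fib e).card = (Fintype.card α - Fintype.card ι).factorial := by
    have hle := Fintype.card_le_of_embedding e
    have h := Finset.card_eq_sum_card_fiberwise (s := (Finset.univ : Finset (Equiv.Perm α)))
      (t := (Finset.univ : Finset (ι ↪ α))) (f := fun σ => e.trans σ.toEmbedding) (by simp)
    rw [Finset.sum_congr rfl fun f _ => hfib f, Finset.sum_const, Finset.card_univ,
      Finset.card_univ, Fintype.card_perm, Fintype.card_embedding_eq,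
      ← Nat.factorial_mul_descFactorial hle, smul_eq_mul, mul_comm] at h
    exact (Nat.eq_of_mul_eq_mul_left (Nat.descFactorial_pos.2 hle) h).symm
  rw [← Finset.sum_fiberwise (s := Finset.univ) (g := fun σ : Equiv.Perm α =>
    e.trans σ.toEmbedding), Finset.smul_sum]
  refine Finset.sum_congr rfl fun f _ => ?_
  rw [Finset.sum_congr rfl fun σ hσ => congrArg F (Finset.mem_filter.1 hσ).2, Finset.sum_const,
    ← hcard, ← hfib f]

theorem prod_factorial_count (n r : ℕ) :
    ∏ v ∈ (List.replicate n 1 ++ List.replicate r 0).toFinset,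
      ((List.replicate n 1 ++ List.replicate r 0).count v).factorial =
      n.factorial * r.factorial := by
  -- If `n` or `r` is zero, the missing value contributes `0! = 1`, so the product may run over both
  -- values in every case.
  rw [Finset.prod_subset (s₂ := {0, 1})]
  · simp [List.count_replicate, mul_comm]
  · intro v hv
    simp only [List.toFinset_append, Finset.mem_union, List.mem_toFinset, List.mem_replicate] at hv
    simp only [Finset.mem_insert, Finset.mem_singleton]
    tauto
  · intro v _ hv
    rw [List.mem_toFinset] at hv
    rw [List.count_eq_zero_of_not_mem hv, Nat.factorial_zero]

theorem getD_zero_ones (n r i : ℕ) :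
    ([0] ++ (List.replicate n 1 ++ List.replicate r 0)).getD i 0 =
      if 0 < i ∧ i < n + 1 then 1 else 0 := by
  rcases i with _ | i
  · simp
  · simp [List.getD_eq_getElem?_getD, List.getElem?_append, List.getElem?_replicate]
    split_ifs <;> simp

/-- The monomial symmetrized in `ẽ_n` is the term of one reference embedding `e`. With `N = n + 1 +
r`, its translates under permutations hit each embedding `r!` times, and the normalization is `1 /
(n! r!)`. -/
theorem sum_embedding_eq_elemTilde [CharZero k] {V : Type*} [Fintype V] [DecidableEq V] (w : V) {n : ℕ}
    (hV : Fintype.card V = n + 1) (N : ℕ) :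
    ∑ f : V ↪ Fin N, (∏ v ∈ Finset.univ.erase w, MvPolynomial.X (f v) : MvPolynomial (Fin N) k)
      ⊗ₜ[k] ExteriorAlgebra.ι k (Pi.single (f w) 1) = (n.factorial : k) • elemTilde k n N := by
  rcases Nat.lt_or_ge N (n + 1) with hN | hN
  · have : IsEmpty (V ↪ Fin N) := ⟨fun f => by
      have := Fintype.card_le_of_embedding f
      rw [Fintype.card_fin, hV] at this
      omega⟩
    rw [elemTilde_eq_zero k hN, smul_zero, Finset.univ_eq_empty, Finset.sum_empty]
  obtain ⟨r, rfl⟩ := Nat.exists_eq_add_of_le hN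
  let g₀ := Fintype.equivFinOfCardEq hV
  -- The swap puts `w` at index `0`, the position carrying the odd variable and exponent zero in the
  -- superpartition `(0; 1^n)`.
  let g : V ≃ Fin (n + 1) := g₀.trans (Equiv.swap (g₀ w) 0)
  have hg : g w = 0 := by simp [g]
  let e : V ↪ Fin (n + 1 + r) := g.toEmbedding.trans (Fin.castAddEmb r)
  have he : e w = 0 := by
    ext
    simp [e, hg]
  have hprod : (∏ i : Fin (n + 1 + r), (MvPolynomial.X i : MvPolynomial (Fin (n + 1 + r)) k) ^
      ([0] ++ (List.replicate n 1 ++ List.replicate r 0)).getD i 0) =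
      ∏ v ∈ Finset.univ.erase w, MvPolynomial.X (e v) := by
    simp only [getD_zero_ones, pow_ite, pow_one, pow_zero]
    rw [← Finset.prod_filter, ← Finset.prod_map (Finset.univ.erase w) e MvPolynomial.X]
    refine Finset.prod_congr ?_ fun _ _ => rfl
    ext i
    simp only [Finset.mem_filter, Finset.mem_univ, true_and, Finset.mem_map, Finset.mem_erase,
      and_true]
    constructor
    · rintro ⟨h0, h1⟩
      refine ⟨g.symm ⟨i, h1⟩, fun h => ?_, ?_⟩
      · rw [Equiv.symm_apply_eq, hg, Fin.ext_iff] at h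
        exact h0.ne' h
      · ext
        simp [e]
    · rintro ⟨v, hv, rfl⟩
      refine ⟨Nat.pos_of_ne_zero fun h => hv (e.injective ?_), (g v).2⟩
      rw [he]
      exact Fin.ext h
  have hlist : (((List.finRange (n + 1 + r)).take 1).map fun i =>
      ExteriorAlgebra.ι k (Pi.single i (1 : k) : Fin (n + 1 + r) → k)).prod =
      ExteriorAlgebra.ι k (Pi.single (e w) 1) := by
    have : (List.finRange (n + 1 + r)).take 1 = [0] := by
      apply List.ext_getElem
      · simp only [List.length_take, List.length_finRange, List.length_singleton]
        omega
      · simp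
    rw [this, he]
    simp
  have hmon : elemTilde k n (n + 1 + r) = ((n.factorial * r.factorial : ℕ) : k)⁻¹ •
      ∑ σ : Equiv.Perm (Fin (n + 1 + r)), permAct k σ
        ((∏ v ∈ Finset.univ.erase w, MvPolynomial.X (e v)) ⊗ₜ[k]
          ExteriorAlgebra.ι k (Pi.single (e w) 1)) := by
    have hr : n + 1 + r - (1 + n) = r := by omega
    rw [elemTilde, monomialSym, if_pos (by simp [SuperPartition.zeroOnes]; omega)]
    simp only [SuperPartition.zeroOnes, List.length_singleton, List.length_replicate, hr]
    rw [prod_factorial_count, hprod, hlist]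
  have hperm : ∀ σ : Equiv.Perm (Fin (n + 1 + r)), permAct k σ
        ((∏ v ∈ Finset.univ.erase w, MvPolynomial.X (e v)) ⊗ₜ[k]
          ExteriorAlgebra.ι k (Pi.single (e w) 1)) =
      (∏ v ∈ Finset.univ.erase w, MvPolynomial.X ((e.trans σ.toEmbedding) v)) ⊗ₜ[k]
        ExteriorAlgebra.ι k (Pi.single ((e.trans σ.toEmbedding) w) 1) := by
    intro σ
    simp [permAct, subst]
  rw [hmon, Finset.sum_congr rfl fun σ _ => hperm σ,
    sum_perm_comp_embedding e fun f => (∏ v ∈ Finset.univ.erase w,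
      MvPolynomial.X (f v) : MvPolynomial (Fin (n + 1 + r)) k)
      ⊗ₜ[k] ExteriorAlgebra.ι k (Pi.single (f w) 1), Fintype.card_fin, hV,
    Nat.add_sub_cancel_left, ← Nat.cast_smul_eq_nsmul k, smul_smul, smul_smul]
  have h1 : (n.factorial : k) ≠ 0 := Nat.cast_ne_zero.2 n.factorial_ne_zero
  have h2 : (r.factorial : k) ≠ 0 := Nat.cast_ne_zero.2 r.factorial_ne_zero
  have h3 : (n.factorial : k) * (((n.factorial * r.factorial : ℕ) : k)⁻¹ * r.factorial) = 1 := by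
    push_cast
    field_simp
  rw [mul_assoc, h3, one_smul]

/-- In a complete graph any two distinct vertices are adjacent, so properness of a colouring means
injectivity. -/
theorem chromaticPoly_top [CharZero k] {V : Type*} [Finite V] {W : Set V} {n : ℕ}
    (hV : Nat.card V = n + 1) (hW : W.ncard = 1) (N : ℕ) :
    chromaticPoly k N (⊤ : SimpleGraph V) W = (n.factorial : k) • elemTilde k n N := by
  classical
  obtain ⟨w, rfl⟩ := Set.ncard_eq_one.1 hW
  have := Fintype.ofFinite V
  have := Fintype.ofFinite ((⊤ : SimpleGraph V).Coloring (Fin N))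
  rw [Nat.card_eq_fintype_card] at hV
  rw [chromaticPoly_singleton, ← sum_embedding_eq_elemTilde k w hV]
  let toEmb (κ : (⊤ : SimpleGraph V).Coloring (Fin N)) : V ↪ Fin N :=
    ⟨κ, fun v v' h => by_contra fun hne => κ.valid ((SimpleGraph.top_adj _ _).2 hne) h⟩
  let E : (⊤ : SimpleGraph V).Coloring (Fin N) ≃ (V ↪ Fin N) :=
    { toFun := toEmb
      invFun := fun f => SimpleGraph.Coloring.mk f fun hvw h => hvw (f.injective h)
      left_inv := fun κ => rfl
      right_inv := fun f => rfl }
  exact Fintype.sum_equiv E _ _ fun κ => rfl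

end CompleteGraph

end SuperChromatic

end

theorem proposition5p5 (k : Type*) [Field k] [CharZero k] :
    (∃! Ψ : SuperChromatic.Chrom k →ₐ[k] SuperChromatic.SymFun k,
      SuperChromatic.IsChromaticMorphism k Ψ) ∧
    ∀ Ψ : SuperChromatic.Chrom k →ₐ[k] SuperChromatic.SymFun k,
      SuperChromatic.IsChromaticMorphism k Ψ →
      ∀ (n : ℕ) (V : Type*) [Finite V] (W : Set V), Nat.card V = n + 1 →
        ∀ hW : W.ncard = 1,
          (Ψ (SuperChromatic.Chrom.cls k (⊤ : SimpleGraph V) W hW.le) :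
              ∀ N, SuperChromatic.SuperPoly k N) =
            (n.factorial : k) • SuperChromatic.elemTilde k n := by
  have h := SuperChromatic.isChromaticMorphism_chromaticHom k
  refine ⟨⟨_, h, fun Ψ hΨ => hΨ.unique h⟩, fun Ψ hΨ n V _ W hV hW => ?_⟩
  obtain rfl := hΨ.unique h
  funext N
  exact (SuperChromatic.chromaticHom_cls k _ W hW.le N).trans
    (SuperChromatic.chromaticPoly_top k hV hW N)
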